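/- Let $1<\gamma<3$ and consider a polytropic gas with states $U=(\rho,u,p)$, $\rho,p>0$, in a duct with cross-section $a>0$, with entropy function $\kappa=p/\rho^{\gamma}$, sound speed $c=\sqrt{\gamma p/\rho}$ and energy $E=\frac{p}{(\gamma-1)\rho}+\frac{u^2}{2}$; a state is called supersonic if $u>c$. In each of the following elementary waves $U_0$ is the left and $U$ the right state. * Stationary wave $S_0(U,U_0)$ (speed $0$, $a\ne a_0$): $a\rho u$, $\frac{u^2}{2}+\frac{c^2}{\gamma-1}$ and $\kappa$ are constant, and along the curve of solutions of these relations from $U_0$ to $U$ the cross-section is a monotone function of the density. * The other waves have constant $a$. Contact discontinuity $J(U,U_0)$ (speed $u$): $u=u_0$, $p=p_0$, $\rho\neq\rho_0$. * Rarefaction waves: $R_1(U,U_0)$ has $\kappa$ and $u+\frac{2c}{\gamma-1}$ constant and $p<p_0$; $R_3(U,U_0)$ has $\kappa$ and $u-\frac{2c}{\gamma-1}$ constant and $p>p_0$. Here $U$ in $R_1$, respectively $U_0$ in $R_3$, may be a vacuum ($\rho=p=c=0$). The edges have the speeds $\lambda_1=u-c$, respectively $\lambda_3=u+c$, of the two states.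 * Shock waves $S_i(U,U_0)$, $i=1,3$, of speed $\sigma$: the Rankine–Hugoniot relations of the gas dynamics equations for $(\rho,\rho u,\rho E)$ and the Lax condition $\lambda_i(U)<\sigma<\lambda_i(U_0)$. In a fan $w_1\oplus w_2\oplus\cdots$ of elementary waves, listed from left to right, neighbours share the state between them (or have a vacuum region between them) and no wave is slower than its left neighbour. We write $J(U_m,U_-)\oplus S_0(U_+,U_m)\to F$ if the contact discontinuity runs into the stationary wave and $F$ is a fan with leftmost state $U_-$ and rightmost state $U_+$, that is, one which solves the Riemann problem arising at the collision. **Lemma 3.3.** Let $U_-$ and $U_m$ (cross-section $a_0$) be joined by a contact discontinuity $J(U_m,U_-)$, and $U_m$ and $U_+$ (cross-section $a_1$) by a stationary wave $S_0(U_+,U_m)$, with $a_0<a_1$. Let $U_m$ and $U_-$ both be supersonic. Then there is exactly one state $U_{-*}$ with cross-section $a_1$ that is joined to $U_-$ by a stationary wave $S_0(U_{-*},U_-)$; it is supersonic, and the following holds. 1. Let $\rho_->\rho_m$. * If $u_{-*}+\frac{2}{\gamma-1}c_{-*}>u_+-\frac{2}{\gamma-1}c_+$, there are unique states $U_2,\overline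 U_2$ with $$J(U_m,U_-)\oplus S_0(U_+,U_m)\to S_0(U_{-*},U_-)\oplus R_1(U_2,U_{-*})\oplus J(\overline U_2,U_2)\oplus R_3(U_+,\overline U_2).$$ * If $u_{-*}+\frac{2}{\gamma-1}c_{-*}\le u_+-\frac{2}{\gamma-1}c_+$, there are no such states, a vacuum appears, and $$J(U_m,U_-)\oplus S_0(U_+,U_m)\to S_0(U_{-*},U_-)\oplus R_1(\mathrm{Vacuum},U_{-*})\oplus R_3(U_+,\mathrm{Vacuum}).$$ 2. If $\rho_-<\rho_m$, there are unique states $U_3,\overline U_3$ and unique shock speeds $\sigma_1,\sigma_3$, with $\sigma_1>0$, such that $$J(U_m,U_-)\oplus S_0(U_+,U_m)\to S_0(U_{-*},U_-)\oplus S_1(U_3,U_{-*})\oplus J(\overline U_3,U_3)\oplus S_3(U_+,\overline U_3).$$ -/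

import Mathlib

noncomputable section

namespace Duct

/-- A fluid state in the duct: density `ρ`, velocity `u`, pressure `p`, cross-section `a`.
The gas is polytropic with exponent `γ`, `p = κ(S) ρ ^ γ`, so the entropy `S` is determined by
`κ = p / ρ ^ γ`. -/
@[ext]
structure State where
  ρ : ℝ
  u : ℝ
  p : ℝ
  a : ℝ

namespace State

/-- A genuine (non-vacuum) gas state. -/
def IsGas (U : State) : Prop := 0 < U.ρ ∧ 0 < U.p ∧ 0 < U.a

/-- A vacuum state; its velocity is the velocity of the adjacent edge of the gas. -/
def IsVacuum (U : State) : Prop := U.ρ = 0 ∧ U.p = 0 ∧ 0 < U.a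

/-- The entropy function `κ = p / ρ ^ γ`. -/
def kappa (γ : ℝ) (U : State) : ℝ := U.p / U.ρ ^ γ

/-- The sound speed `c = √(∂p/∂ρ) = √(γ p / ρ)`; it evaluates to `0` at a vacuum state, which is
its limit along an isentrope. -/
def c (γ : ℝ) (U : State) : ℝ := √(γ * U.p / U.ρ)

/-- The total energy per unit mass `E = e + u² / 2`, with `e = p / ((γ - 1) ρ)`. -/
def E (γ : ℝ) (U : State) : ℝ := U.p / ((γ - 1) * U.ρ) + U.u ^ 2 / 2

/-- The first characteristic speed `u - c`. -/
def lam1 (γ : ℝ) (U : State) : ℝ := U.u - U.c γ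

/-- The third characteristic speed `u + c`. -/
def lam3 (γ : ℝ) (U : State) : ℝ := U.u + U.c γ

/-- Supersonic (rightward) flow: `u > c`. -/
def Supersonic (γ : ℝ) (U : State) : Prop := U.c γ < U.u

end State

open State

/-! In all wave relations below `U` is the right-hand and `U₀` the left-hand state. -/

/-- The backward rarefaction wave `R₁(U, U₀)`: `a`, the entropy and `u + 2c/(γ-1)` are constant and
`p < p₀`. The right-hand state may be the vacuum. -/
def IsR1 (γ : ℝ) (U U₀ : State) : Prop :=
  U₀.IsGas ∧ (U.IsGas ∨ U.IsVacuum) ∧ U.a = U₀.a ∧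
    U.p * U₀.ρ ^ γ = U₀.p * U.ρ ^ γ ∧
    U.u = U₀.u - 2 / (γ - 1) * (U.c γ - U₀.c γ) ∧ U.p < U₀.p

/-- The forward rarefaction wave `R₃(U, U₀)`: `a`, the entropy and `u - 2c/(γ-1)` are constant and
`p > p₀`. The left-hand state may be the vacuum. -/
def IsR3 (γ : ℝ) (U U₀ : State) : Prop :=
  (U₀.IsGas ∨ U₀.IsVacuum) ∧ U.IsGas ∧ U.a = U₀.a ∧
    U.p * U₀.ρ ^ γ = U₀.p * U.ρ ^ γ ∧
    U.u = U₀.u + 2 / (γ - 1) * (U.c γ - U₀.c γ) ∧ U₀.p < U.p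

/-- The Rankine–Hugoniot relations of the gas dynamics equations for a discontinuity of
speed `σ`, across which the cross-section is constant. -/
def RankineHugoniot (γ σ : ℝ) (U U₀ : State) : Prop :=
  U.a = U₀.a ∧
  -σ * (U.ρ - U₀.ρ) + (U.ρ * U.u - U₀.ρ * U₀.u) = 0 ∧
  -σ * (U.ρ * U.u - U₀.ρ * U₀.u)
    + ((U.ρ * U.u ^ 2 + U.p) - (U₀.ρ * U₀.u ^ 2 + U₀.p)) = 0 ∧
  -σ * (U.ρ * U.E γ - U₀.ρ * U₀.E γ)
    + (U.u * (U.ρ * U.E γ + U.p) - U₀.u * (U₀.ρ * U₀.E γ + U₀.p)) = 0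

/-- The backward shock wave `S₁(U, U₀)` of speed `σ`, with the Lax shock condition. -/
def IsS1 (γ σ : ℝ) (U U₀ : State) : Prop :=
  U₀.IsGas ∧ U.IsGas ∧ RankineHugoniot γ σ U U₀ ∧ U.lam1 γ < σ ∧ σ < U₀.lam1 γ

/-- The forward shock wave `S₃(U, U₀)` of speed `σ`, with the Lax shock condition. -/
def IsS3 (γ σ : ℝ) (U U₀ : State) : Prop :=
  U₀.IsGas ∧ U.IsGas ∧ RankineHugoniot γ σ U U₀ ∧ U.lam3 γ < σ ∧ σ < U₀.lam3 γ

/-- The contact discontinuity `J(U, U₀)`. -/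
def IsJ (U U₀ : State) : Prop :=
  U₀.IsGas ∧ U.IsGas ∧ U.a = U₀.a ∧ U.u = U₀.u ∧ U.p = U₀.p ∧ U.ρ ≠ U₀.ρ

/-- The cross-section along the stationary curve through `U₀`, as a function of the density `r`:
conservation of entropy and of `u²/2 + κγ/(γ-1) ρ^(γ-1)` gives `|u|` as a function of `r`, and
conservation of `a ρ u` then gives the cross-section. -/
def stationaryArea (γ : ℝ) (U₀ : State) (r : ℝ) : ℝ :=
  U₀.a * U₀.ρ * |U₀.u| /
    (r * √(U₀.u ^ 2 + 2 * (U₀.kappa γ * γ / (γ - 1)) * (U₀.ρ ^ (γ - 1) - r ^ (γ - 1))))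

/-- The stationary wave `S₀(U, U₀)`: the cross-section jumps, the Riemann invariants `a ρ u`,
`u²/2 + c²/(γ-1)` and the entropy are constant, and the global entropy condition holds: along the
stationary curve from `U₀` to `U` the cross-section is a monotone function of the density. -/
def IsS0 (γ : ℝ) (U U₀ : State) : Prop :=
  U₀.IsGas ∧ U.IsGas ∧ U.a ≠ U₀.a ∧
    U₀.a * U₀.ρ * U₀.u = U.a * U.ρ * U.u ∧
    U₀.u ^ 2 / 2 + U₀.c γ ^ 2 / (γ - 1) = U.u ^ 2 / 2 + U.c γ ^ 2 / (γ - 1) ∧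
    U₀.kappa γ = U.kappa γ ∧
    (MonotoneOn (stationaryArea γ U₀) (Set.uIcc U₀.ρ U.ρ) ∨
      AntitoneOn (stationaryArea γ U₀) (Set.uIcc U₀.ρ U.ρ))

/-- The elementary waves. The arguments are the right-hand state, the left-hand state and, for a
shock, its speed. -/
inductive Wave where
  | S0 (U U₀ : State)
  | J (U U₀ : State)
  | R1 (U U₀ : State)
  | R3 (U U₀ : State)
  | S1 (U U₀ : State) (σ : ℝ)
  | S3 (U U₀ : State) (σ : ℝ)

namespace Wave

/-- The state on the right of a wave. -/
def right : Wave → State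
  | S0 U _ => U
  | J U _ => U
  | R1 U _ => U
  | R3 U _ => U
  | S1 U _ _ => U
  | S3 U _ _ => U

/-- The state on the left of a wave. -/
def left : Wave → State
  | S0 _ U₀ => U₀
  | J _ U₀ => U₀
  | R1 _ U₀ => U₀
  | R3 _ U₀ => U₀
  | S1 _ U₀ _ => U₀
  | S3 _ U₀ _ => U₀

/-- The speed of the left edge of a wave. -/
def leftSpeed (γ : ℝ) : Wave → ℝ
  | S0 _ _ => 0
  | J _ U₀ => U₀.u
  | R1 _ U₀ => U₀.lam1 γ
  | R3 _ U₀ => U₀.lam3 γ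
  | S1 _ _ σ => σ
  | S3 _ _ σ => σ

/-- The speed of the right edge of a wave. -/
def rightSpeed (γ : ℝ) : Wave → ℝ
  | S0 _ _ => 0
  | J U _ => U.u
  | R1 U _ => U.lam1 γ
  | R3 U _ => U.lam3 γ
  | S1 _ _ σ => σ
  | S3 _ _ σ => σ

/-- The two states of the wave are related as the kind of the wave requires. -/
def Valid (γ : ℝ) : Wave → Prop
  | S0 U U₀ => IsS0 γ U U₀
  | J U U₀ => IsJ U U₀
  | R1 U U₀ => IsR1 γ U U₀
  | R3 U U₀ => IsR3 γ U U₀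
  | S1 U U₀ σ => IsS1 γ σ U U₀
  | S3 U U₀ σ => IsS3 γ σ U U₀

/-- `w ⊕ w'`: the wave `w'` follows `w` (on its right) in a self-similar fan. They share the state
between them, or have a vacuum region between them, and `w'` is not slower than `w`. -/
def FollowedBy (γ : ℝ) (w w' : Wave) : Prop :=
  (w.right = w'.left ∨
    (w.right.IsVacuum ∧ w'.left.IsVacuum ∧ w.right.a = w'.left.a)) ∧
  w.rightSpeed γ ≤ w'.leftSpeed γ

/-- Two neighbouring waves share the state between them and run into each other: the left one,
`w`, is faster than the right one, `w'`. -/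
def RunsInto (γ : ℝ) (w w' : Wave) : Prop :=
  w.right = w'.left ∧ w'.leftSpeed γ < w.rightSpeed γ

end Wave

/-- `w₁ ⊕ w₂ → out`: the elementary waves `w₁` (left) and `w₂` (right) run into each other, and the
Riemann problem that arises at the collision, with the state on the left of `w₁` and the state on
the right of `w₂` as data, is solved by the fan of elementary waves `out`, listed from left to
right. -/
structure Interaction (γ : ℝ) (w₁ w₂ : Wave) (out : List Wave) : Prop where
  valid_left : w₁.Valid γ
  valid_right : w₂.Valid γ
  runsInto : w₁.RunsInto γ w₂
  valid_out : ∀ w ∈ out, w.Valid γ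
  chain_out : out.IsChain (Wave.FollowedBy γ)
  left_out : out.head?.map Wave.left = some w₁.left
  right_out : out.getLast?.map Wave.right = some w₂.right

end Duct

end

/-! ### Calculus of the mass flux along a stationary curve. -/

namespace Duct

open Set

/-! A stationary wave is governed by the density ratio `r`: conservation of entropy and energy fixes
the velocity `v`, and conservation of mass prescribes the flux `r v`. For supersonic data the flux
increases up to the sonic ratio, which exceeds 1, and the monotonicity of the cross-section excludes
`r ≥ 1`. So a supersonic state has exactly one stationary transition into a wider duct, and it stays
supersonic (`IsS0.exists_expansion`, `exists_expansion`, `Expansion.unique`).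

The states U₋ and Uₘ share velocity and pressure, so their flux functions differ only in the sound
speed. If `x` is the quotient of the two density ratios, then p₊ = p₋* x^γ and u₊ = u₋*/x
(`Expansion.ratio`), with x < 1 for ρ₋ > ρₘ and x > 1 for ρ₋ < ρₘ.

What remains is a Riemann problem with constant cross-section between U₋* and U₊: find the pressure
`p` at which the backward curve of U₋* and the forward curve of U₊ have the same velocity. After
reflecting U₊, the sum of two backward-curve velocities has to vanish. This sum is strictly
decreasing in `p`, so uniqueness is immediate and existence is a sign check at two ends.

For rarefactions the ends are 0 and p₊. The sum is negative at p₊ because U₋* is supersonic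
(`rareVelocity_lt`), and its sign at 0 is the vacuum criterion. For shocks the ends are p₊ and the
pressure behind a standing shock. The sum is positive at p₊ because the isentrope lies below the
Hugoniot curve (`lt_shockVelocity`), and negative at the other end by Prandtl's relation
(`shockVelocity_standingPressure`). A root below the standing pressure has σ₁ > 0. -/

/-- The square of the mass flux `r v` along the stationary curve, per unit initial density and as a
function of the density ratio `r`. -/
noncomputable def stationaryFlux (γ u s r : ℝ) : ℝ :=
  r ^ 2 * (u ^ 2 + 2 * s / (γ - 1) * (1 - r ^ (γ - 1)))

theorem continuous_stationaryFlux {γ : ℝ} (hγ : 1 < γ) (u s : ℝ) :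
    Continuous (stationaryFlux γ u s) := by
  unfold stationaryFlux
  have : Continuous fun r : ℝ => r ^ (γ - 1) := Real.continuous_rpow_const (by linarith)
  fun_prop

theorem hasDerivAt_stationaryFlux {γ : ℝ} (hγ : 1 < γ) (u s : ℝ) {r : ℝ} (hr : 0 < r) :
    HasDerivAt (stationaryFlux γ u s)
      (2 * r / (γ - 1) * ((γ - 1) * u ^ 2 + 2 * s - (γ + 1) * s * r ^ (γ - 1))) r := by
  have h0 : γ - 1 ≠ 0 := by linarith
  have h1 : HasDerivAt (fun r : ℝ => r ^ (γ - 1)) ((γ - 1) * r ^ (γ - 1 - 1)) r :=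
    Real.hasDerivAt_rpow_const (Or.inl hr.ne')
  have h2 := ((hasDerivAt_id r).pow 2).mul
    (((h1.const_sub 1).const_mul (2 * s / (γ - 1))).const_add (u ^ 2))
  have h3 : r ^ (γ - 1) = r ^ (γ - 1 - 1) * r := by
    rw [← Real.rpow_add_one hr.ne']; ring_nf
  refine h2.congr_deriv ?_
  simp only [id, Pi.pow_apply, h3]
  field_simp
  ring

/-- The derivative of the squared flux is `2 r (v² - c²)` for the velocity and sound speed at ratio
`r`, and `hR` says that the sonic point is not passed before `R`. -/
theorem strictMonoOn_stationaryFlux {γ u s R : ℝ} (hγ : 1 < γ) (hs : 0 < s)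
    (hR : (γ + 1) * s * R ^ (γ - 1) ≤ (γ - 1) * u ^ 2 + 2 * s) :
    StrictMonoOn (stationaryFlux γ u s) (Icc 0 R) := by
  refine strictMonoOn_of_deriv_pos (convex_Icc 0 R) (continuous_stationaryFlux hγ u s).continuousOn
    fun r hr => ?_
  rw [interior_Icc] at hr
  rw [(hasDerivAt_stationaryFlux hγ u s hr.1).deriv]
  have h1 : r ^ (γ - 1) < R ^ (γ - 1) := Real.rpow_lt_rpow hr.1.le hr.2 (by linarith)
  have h2 : (γ + 1) * s * r ^ (γ - 1) < (γ + 1) * s * R ^ (γ - 1) :=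
    mul_lt_mul_of_pos_left h1 (by have : 0 < γ + 1 := by linarith
                                  positivity)
  have : 0 < 2 * r / (γ - 1) := div_pos (by linarith [hr.1]) (by linarith)
  exact mul_pos this (by linarith)

theorem strictMonoOn_stationaryFlux_unit {γ u s : ℝ} (hγ : 1 < γ) (hs : 0 < s) (hsu : s < u ^ 2) :
    StrictMonoOn (stationaryFlux γ u s) (Icc 0 1) := by
  refine strictMonoOn_stationaryFlux hγ hs ?_
  rw [Real.one_rpow]
  nlinarith

/-- The sonic ratio serves as `R`; the strict inequality `1 < R` is what later excludes compressive
stationary waves. -/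
theorem exists_strictMonoOn_stationaryFlux {γ u s : ℝ} (hγ : 1 < γ) (hs : 0 < s)
    (hsu : s < u ^ 2) : ∃ R, 1 < R ∧ StrictMonoOn (stationaryFlux γ u s) (Icc 0 R) := by
  set K := ((γ - 1) * u ^ 2 + 2 * s) / ((γ + 1) * s) with hK
  have hpos : 0 < (γ + 1) * s := mul_pos (by linarith) hs
  have hK1 : 1 < K := by
    rw [hK, one_lt_div hpos]
    nlinarith
  refine ⟨K ^ (1 / (γ - 1)), Real.one_lt_rpow hK1 (by have : 0 < γ - 1 := by linarith
                                                      positivity), ?_⟩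
  refine strictMonoOn_stationaryFlux hγ hs ?_
  rw [← Real.rpow_mul (by linarith), one_div_mul_cancel (by linarith : γ - 1 ≠ 0), Real.rpow_one,
    hK, mul_div_cancel₀ _ hpos.ne']

theorem stationaryFlux_one (γ u s : ℝ) : stationaryFlux γ u s 1 = u ^ 2 := by
  simp [stationaryFlux]

/-- A larger sound speed gives a smaller density on the supersonic branch. -/
theorem lt_of_stationaryFlux_eq {γ u s s' r r' : ℝ} (hγ : 1 < γ) (hs : 0 < s) (hss : s < s')
    (hsu : s < u ^ 2) (hr : r ∈ Ioo (0 : ℝ) 1) (hr' : r' ∈ Ioo (0 : ℝ) 1)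
    (h : stationaryFlux γ u s r = stationaryFlux γ u s' r') : r' < r := by
  -- It suffices to compare both fluxes at the same ratio `r'`, where the larger sound speed gives
  -- more since `1 - r' ^ (γ - 1) > 0`.
  refine ((strictMonoOn_stationaryFlux_unit hγ hs hsu).lt_iff_lt
    (Ioo_subset_Icc_self hr') (Ioo_subset_Icc_self hr)).1 ?_
  rw [h]
  have h1 : r' ^ (γ - 1) < 1 := Real.rpow_lt_one hr'.1.le hr'.2 (by linarith)
  have h2 : 2 * s / (γ - 1) < 2 * s' / (γ - 1) :=
    div_lt_div_of_pos_right (by linarith) (by linarith)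
  have := hr'.1
  unfold stationaryFlux
  refine mul_lt_mul_of_pos_left ?_ (by positivity)
  nlinarith [mul_lt_mul_of_pos_right h2 (sub_pos.2 h1)]

/-! ### Inequalities for shocks and isentropes. -/

/-- Up to a constant, minus the logarithm of the entropy `κ` behind a shock of strength `x`. -/
noncomputable def shockEntropy (γ x : ℝ) : ℝ :=
  γ * (Real.log ((γ + 1) * x + (γ - 1)) - Real.log ((γ - 1) * x + (γ + 1))) - Real.log x

/-- Over a common denominator the derivative has numerator `-(γ² - 1)(x - 1)²`. -/
theorem strictAntiOn_shockEntropy {γ : ℝ} (hγ : 1 < γ) :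
    StrictAntiOn (shockEntropy γ) (Ici 1) := by
  have hd : ∀ x : ℝ, 1 ≤ x → HasDerivAt (shockEntropy γ)
      (γ * ((γ + 1) / ((γ + 1) * x + (γ - 1)) - (γ - 1) / ((γ - 1) * x + (γ + 1))) - 1 / x) x := by
    intro x hx
    have hA : (γ + 1) * x + (γ - 1) ≠ 0 := by nlinarith
    have hB : (γ - 1) * x + (γ + 1) ≠ 0 := by nlinarith
    have h1 : HasDerivAt (fun x : ℝ => (γ + 1) * x + (γ - 1)) (γ + 1) x := by
      simpa using ((hasDerivAt_id x).const_mul (γ + 1)).add_const (γ - 1)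
    have h2 : HasDerivAt (fun x : ℝ => (γ - 1) * x + (γ + 1)) (γ - 1) x := by
      simpa using ((hasDerivAt_id x).const_mul (γ - 1)).add_const (γ + 1)
    have h3 := ((h1.log hA).sub (h2.log hB)).const_mul γ
    exact h3.sub ((hasDerivAt_id x).log (by simp; linarith))
  refine strictAntiOn_of_deriv_neg (convex_Ici 1)
    (fun x hx => (hd x hx).continuousAt.continuousWithinAt) fun x hx => ?_
  rw [interior_Ici] at hx
  have hx1 : 1 < x := hx
  rw [(hd x hx1.le).deriv]
  have hA : 0 < (γ + 1) * x + (γ - 1) := by nlinarith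
  have hB : 0 < (γ - 1) * x + (γ + 1) := by nlinarith
  have hx0 : 0 < x := by linarith
  have : γ * ((γ + 1) / ((γ + 1) * x + (γ - 1)) - (γ - 1) / ((γ - 1) * x + (γ + 1))) - 1 / x
      = -((γ ^ 2 - 1) * (x - 1) ^ 2) /
        (((γ + 1) * x + (γ - 1)) * ((γ - 1) * x + (γ + 1)) * x) := by
    rw [div_sub_div _ _ hA.ne' hB.ne', mul_div_assoc', div_sub_div _ _ (by positivity) hx0.ne']
    congr 1
    ring
  rw [this]
  refine div_neg_of_neg_of_pos ?_ (by positivity)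
  have h1 : 0 < γ ^ 2 - 1 := by nlinarith
  have h2 : 0 < (x - 1) ^ 2 := pow_pos (by linarith) 2
  linarith [mul_pos h1 h2]

/-- The isentrope lies below the Hugoniot curve. -/
theorem rpow_mul_le_of_one_le {γ x : ℝ} (hγ : 1 < γ) (hx : 1 ≤ x) :
    x ^ γ * ((γ + 1) - (γ - 1) * x) ≤ (γ + 1) * x - (γ - 1) := by
  have hx0 : 0 < x := by linarith
  have hP : 1 ≤ x ^ γ := Real.one_le_rpow hx (by linarith)
  -- Evaluated at pressure ratio `x ^ γ`, the entropy inequality says that the density ratio on the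
  -- Hugoniot curve is at most `x`.
  have h := (strictAntiOn_shockEntropy hγ).antitoneOn (mem_Ici.2 le_rfl) (mem_Ici.2 hP) hP
  have hA : 0 < (γ + 1) * x ^ γ + (γ - 1) := by nlinarith
  have hB : 0 < (γ - 1) * x ^ γ + (γ + 1) := by nlinarith
  have h1 : shockEntropy γ 1 = 0 := by
    simp only [shockEntropy, mul_one, Real.log_one]
    ring_nf
  rw [h1] at h
  unfold shockEntropy at h
  rw [Real.log_rpow hx0] at h
  have h2 : γ * (Real.log ((γ + 1) * x ^ γ + (γ - 1)) - Real.log ((γ - 1) * x ^ γ + (γ + 1)))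
      ≤ γ * Real.log x := by linarith
  have h3 := le_of_mul_le_mul_left h2 (by linarith)
  have h4 : Real.log ((γ + 1) * x ^ γ + (γ - 1)) ≤ Real.log (x * ((γ - 1) * x ^ γ + (γ + 1))) := by
    rw [Real.log_mul hx0.ne' hB.ne']
    linarith
  have h5 := (Real.log_le_log_iff hA (by positivity)).1 h4
  linarith

/-- Both sides are separated by `-log x`, using `log y ≤ y - 1` at `y = x ^ b` and at `y = 1 / x`.
-/
theorem one_sub_rpow_le {b x : ℝ} (hb : 0 < b) (hx : 0 < x) : (1 - x ^ b) / b ≤ 1 / x - 1 := by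
  have h1 := Real.log_le_sub_one_of_pos (Real.rpow_pos_of_pos hx b)
  have h2 := Real.log_le_sub_one_of_pos (inv_pos.2 hx)
  rw [Real.log_rpow hx] at h1
  rw [Real.log_inv] at h2
  rw [div_le_iff₀ hb, one_div]
  nlinarith

/-- Since `D ≤ x ((γ + 1) - (γ - 1) x)`, the Hugoniot inequality `hPx` can be applied once to each
factor `P - 1`, in the rearranged forms `h2` and `h5`. Here `P` stands for `x ^ γ`. -/
theorem shock_velocity_estimate {γ x D P : ℝ} (hγ : 1 < γ) (hx : 1 < x) (hP : 1 < P)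
    (hPx : P * ((γ + 1) - (γ - 1) * x) ≤ (γ + 1) * x - (γ - 1))
    (hD : D = (γ + 1) - (γ - 1) * x ^ 2) :
    (P - 1) ^ 2 * D ≤ γ * (x - 1) ^ 2 * ((γ + 1) * P + (γ - 1)) := by
  have h1 : D ≤ x * ((γ + 1) - (γ - 1) * x) := by rw [hD]; nlinarith
  have h2 : (P - 1) * ((γ + 1) - (γ - 1) * x) ≤ 2 * γ * (x - 1) := by nlinarith
  have h3 : (P - 1) ^ 2 * D ≤ (P - 1) ^ 2 * (x * ((γ + 1) - (γ - 1) * x)) :=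
    mul_le_mul_of_nonneg_left h1 (sq_nonneg _)
  have h4 : (P - 1) * x * ((P - 1) * ((γ + 1) - (γ - 1) * x)) ≤
      (P - 1) * x * (2 * γ * (x - 1)) :=
    mul_le_mul_of_nonneg_left h2 (mul_nonneg (by linarith) (by linarith))
  have h5 : 2 * (P - 1) * x ≤ (x - 1) * ((γ + 1) * P + (γ - 1)) := by nlinarith
  have h6 := mul_le_mul_of_nonneg_left h5
    (mul_nonneg (by linarith : (0 : ℝ) ≤ γ) (by linarith : (0 : ℝ) ≤ x - 1))
  nlinarith

theorem shock_pressure_estimate {γ x D P : ℝ} (hγ : 1 < γ) (hx : 1 < x) (hP : 1 < P)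
    (hPx : P * ((γ + 1) - (γ - 1) * x) ≤ (γ + 1) * x - (γ - 1))
    (hD : D = (γ + 1) - (γ - 1) * x ^ 2) :
    D * ((γ + 1) * P + (γ - 1)) ≤ 4 * γ * x ^ 2 := by
  have h1 : D ≤ x * ((γ + 1) - (γ - 1) * x) := by rw [hD]; nlinarith
  have h2 : P * D ≤ P * (x * ((γ + 1) - (γ - 1) * x)) :=
    mul_le_mul_of_nonneg_left h1 (by linarith)
  have h3 := mul_le_mul_of_nonneg_left hPx (by linarith : (0 : ℝ) ≤ x)
  have h4 : P * D ≤ x * ((γ + 1) * x - (γ - 1)) := by nlinarith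
  have h5 := mul_le_mul_of_nonneg_left h4 (by linarith : (0 : ℝ) ≤ γ + 1)
  have h6 : 0 ≤ (γ - 1) * (γ + 1) * (x - 1) :=
    mul_nonneg (mul_nonneg (by linarith) (by linarith)) (by linarith)
  rw [hD] at h5 ⊢
  nlinarith

end Duct

/-! ### Sound speed, reflection and the wave curves. -/

namespace Duct

open Set

namespace State

variable {γ : ℝ} {U : State}

theorem IsGas.c_pos (hU : U.IsGas) (hγ : 1 < γ) : 0 < U.c γ := by
  have := hU.1
  have := hU.2.1
  exact Real.sqrt_pos.2 (by positivity)

theorem IsGas.c_sq (hU : U.IsGas) (hγ : 1 < γ) : U.c γ ^ 2 = γ * U.p / U.ρ := by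
  have := hU.1
  have := hU.2.1
  exact Real.sq_sqrt (by positivity)

theorem IsGas.rho_mul_c_sq (hU : U.IsGas) (hγ : 1 < γ) : U.ρ * U.c γ ^ 2 = γ * U.p := by
  rw [hU.c_sq hγ, mul_div_cancel₀ _ hU.1.ne']

theorem IsGas.c_eq (hU : U.IsGas) (hγ : 1 < γ) {x : ℝ} (hx : 0 ≤ x)
    (h : U.ρ * x ^ 2 = γ * U.p) : U.c γ = x := by
  have h1 : U.ρ * U.c γ ^ 2 = U.ρ * x ^ 2 := by rw [hU.rho_mul_c_sq hγ, h]
  exact (sq_eq_sq₀ (hU.c_pos hγ).le hx).1 (mul_left_cancel₀ hU.1.ne' h1)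

/-- The mirror image of a state. -/
def reflect (U : State) : State := { U with u := -U.u }

@[simp] theorem reflect_rho (U : State) : U.reflect.ρ = U.ρ := rfl
@[simp] theorem reflect_u (U : State) : U.reflect.u = -U.u := rfl
@[simp] theorem reflect_p (U : State) : U.reflect.p = U.p := rfl
@[simp] theorem reflect_a (U : State) : U.reflect.a = U.a := rfl
@[simp] theorem reflect_c (γ : ℝ) (U : State) : U.reflect.c γ = U.c γ := rfl
@[simp] theorem reflect_E (γ : ℝ) (U : State) : U.reflect.E γ = U.E γ := by simp [E]
@[simp] theorem reflect_reflect (U : State) : U.reflect.reflect = U := by simp [reflect]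
@[simp] theorem reflect_isGas (U : State) : U.reflect.IsGas ↔ U.IsGas := Iff.rfl
@[simp] theorem reflect_isVacuum (U : State) : U.reflect.IsVacuum ↔ U.IsVacuum := Iff.rfl

theorem IsVacuum.c_eq_zero (hU : U.IsVacuum) (γ : ℝ) : U.c γ = 0 := by simp [c, hU.1]

end State

open State

variable {γ σ : ℝ} {U U₀ : State}

/-- Reflection exchanges left and right and reverses velocities, so only the backward curves need to
be analysed. -/
theorem isR3_iff_reflect : IsR3 γ U U₀ ↔ IsR1 γ U₀.reflect U.reflect := by
  simp only [IsR3, IsR1, reflect_isGas, reflect_isVacuum, reflect_rho, reflect_p, reflect_a,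
    reflect_c, reflect_u]
  constructor
  · rintro ⟨h1, h2, h3, h4, h5, h6⟩
    exact ⟨h2, h1, h3.symm, h4.symm, by rw [h5]; ring, h6⟩
  · rintro ⟨h1, h2, h3, h4, h5, h6⟩
    exact ⟨h2, h1, h3.symm, h4.symm, by linarith, h6⟩

theorem isS3_iff_reflect : IsS3 γ σ U U₀ ↔ IsS1 γ (-σ) U₀.reflect U.reflect := by
  simp only [IsS3, IsS1, RankineHugoniot, lam1, lam3, reflect_isGas, reflect_rho, reflect_p,
    reflect_a, reflect_c, reflect_u, reflect_E]
  constructor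
  · rintro ⟨h1, h2, ⟨h3, h4, h5, h6⟩, h7, h8⟩
    exact ⟨h2, h1, ⟨h3.symm, by linarith, by linarith, by linarith⟩, by linarith, by linarith⟩
  · rintro ⟨h1, h2, ⟨h3, h4, h5, h6⟩, h7, h8⟩
    exact ⟨h2, h1, ⟨h3.symm, by linarith, by linarith, by linarith⟩, by linarith, by linarith⟩

/-! ### Rarefaction waves -/

/-- The velocity at pressure `p` on the backward rarefaction curve of `U₀`. -/
noncomputable def rareVelocity (γ : ℝ) (U₀ : State) (p : ℝ) : ℝ :=
  U₀.u - 2 / (γ - 1) * (U₀.c γ * (p / U₀.p) ^ ((γ - 1) / (2 * γ)) - U₀.c γ)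

/-- The state of pressure `p` on the backward rarefaction curve of `U₀`. -/
noncomputable def rareState (γ : ℝ) (U₀ : State) (p : ℝ) : State :=
  ⟨U₀.ρ * (p / U₀.p) ^ (1 / γ), rareVelocity γ U₀ p, p, U₀.a⟩

theorem rareState_isGas (h₀ : U₀.IsGas) {p : ℝ} (hp : 0 < p) : (rareState γ U₀ p).IsGas :=
  ⟨mul_pos h₀.1 (Real.rpow_pos_of_pos (div_pos hp h₀.2.1) _), hp, h₀.2.2⟩

theorem rareState_c (hγ : 1 < γ) (h₀ : U₀.IsGas) {p : ℝ} (hp : 0 < p) :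
    (rareState γ U₀ p).c γ = U₀.c γ * (p / U₀.p) ^ ((γ - 1) / (2 * γ)) := by
  have hq : 0 < p / U₀.p := div_pos hp h₀.2.1
  have hγ0 : γ ≠ 0 := by linarith
  refine (rareState_isGas h₀ hp).c_eq hγ
    (mul_nonneg (h₀.c_pos hγ).le (Real.rpow_nonneg hq.le _)) ?_
  have h1 : (p / U₀.p) ^ (1 / γ) * ((p / U₀.p) ^ ((γ - 1) / (2 * γ))) ^ 2 = p / U₀.p := by
    rw [← Real.rpow_natCast, ← Real.rpow_mul hq.le, ← Real.rpow_add hq]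
    have : 1 / γ + (γ - 1) / (2 * γ) * ((2 : ℕ) : ℝ) = 1 := by
      push_cast
      field_simp
      ring
    rw [this, Real.rpow_one]
  calc (rareState γ U₀ p).ρ * (U₀.c γ * (p / U₀.p) ^ ((γ - 1) / (2 * γ))) ^ 2
      = U₀.ρ * U₀.c γ ^ 2 * ((p / U₀.p) ^ (1 / γ) * ((p / U₀.p) ^ ((γ - 1) / (2 * γ))) ^ 2) := by
        simp only [rareState]
        ring
    _ = γ * p := by
        have := h₀.2.1.ne'
        rw [h1, h₀.rho_mul_c_sq hγ]
        field_simp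

theorem isR1_rareState (hγ : 1 < γ) (h₀ : U₀.IsGas) {p : ℝ} (hp : 0 < p) (hp' : p < U₀.p) :
    IsR1 γ (rareState γ U₀ p) U₀ := by
  have hq : 0 < p / U₀.p := div_pos hp h₀.2.1
  refine ⟨h₀, Or.inl (rareState_isGas h₀ hp), rfl, ?_, ?_, hp'⟩
  · have h1 : (U₀.ρ * (p / U₀.p) ^ (1 / γ)) ^ γ = U₀.ρ ^ γ * (p / U₀.p) := by
      rw [Real.mul_rpow h₀.1.le (Real.rpow_nonneg hq.le _), ← Real.rpow_mul hq.le,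
        one_div_mul_cancel (by linarith), Real.rpow_one]
    have := h₀.2.1.ne'
    simp only [rareState]
    rw [h1]
    field_simp
  · rw [rareState_c hγ h₀ hp]
    rfl

theorem IsR1.eq_rareState (hγ : 1 < γ) (h : IsR1 γ U U₀) (hU : U.IsGas) :
    U = rareState γ U₀ U.p := by
  obtain ⟨h₀, -, ha, hκ, hu, -⟩ := h
  have hq : 0 < U.p / U₀.p := div_pos hU.2.1 h₀.2.1
  have hρ : U.ρ = (rareState γ U₀ U.p).ρ := by
    have h1 : (U.ρ / U₀.ρ) ^ γ = U.p / U₀.p := by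
      have h2 := (Real.rpow_pos_of_pos h₀.1 γ).ne'
      have h3 := h₀.2.1.ne'
      rw [Real.div_rpow hU.1.le h₀.1.le]
      field_simp
      linarith
    simp only [rareState]
    rw [← h1, ← Real.rpow_mul (div_pos hU.1 h₀.1).le, mul_one_div_cancel (by linarith),
      Real.rpow_one, mul_div_cancel₀ _ h₀.1.ne']
  have hc : U.c γ = (rareState γ U₀ U.p).c γ := by
    unfold State.c
    rw [← hρ]
    rfl
  refine State.ext hρ ?_ rfl ha
  rw [hu, hc, rareState_c hγ h₀ hU.2.1]
  rfl

/-- The rarefaction formula extends to zero pressure and gives the escape velocity into vacuum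
there. -/
theorem rareVelocity_zero (hγ : 1 < γ) (U₀ : State) :
    rareVelocity γ U₀ 0 = U₀.u + 2 / (γ - 1) * U₀.c γ := by
  have : (γ - 1) / (2 * γ) ≠ 0 := (div_pos (by linarith) (by linarith)).ne'
  simp [rareVelocity, Real.zero_rpow this]

theorem rareVelocity_self (h₀ : U₀.IsGas) : rareVelocity γ U₀ U₀.p = U₀.u := by
  simp [rareVelocity, div_self h₀.2.1.ne']

theorem continuous_rareVelocity (hγ : 1 < γ) (U₀ : State) : Continuous (rareVelocity γ U₀) := by
  unfold rareVelocity
  have : Continuous fun r : ℝ => r ^ ((γ - 1) / (2 * γ)) :=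
    Real.continuous_rpow_const (div_pos (by linarith) (by linarith)).le
  fun_prop

theorem strictAntiOn_rareVelocity (hγ : 1 < γ) (h₀ : U₀.IsGas) :
    StrictAntiOn (rareVelocity γ U₀) (Ici 0) := by
  intro p hp q _ hpq
  have h1 : (p / U₀.p) ^ ((γ - 1) / (2 * γ)) < (q / U₀.p) ^ ((γ - 1) / (2 * γ)) :=
    Real.rpow_lt_rpow (div_nonneg hp h₀.2.1.le) (div_lt_div_of_pos_right hpq h₀.2.1)
      (div_pos (by linarith) (by linarith))
  have h2 : 0 < 2 / (γ - 1) * U₀.c γ := mul_pos (div_pos two_pos (by linarith)) (h₀.c_pos hγ)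
  unfold rareVelocity
  nlinarith [mul_lt_mul_of_pos_left h1 h2]

/-- The vacuum at the end of the backward rarefaction curve of `U₀`. -/
noncomputable def rareVacuum (γ : ℝ) (U₀ : State) : State :=
  ⟨0, U₀.u + 2 / (γ - 1) * U₀.c γ, 0, U₀.a⟩

theorem rareVacuum_isVacuum (h₀ : U₀.IsGas) : (rareVacuum γ U₀).IsVacuum := ⟨rfl, rfl, h₀.2.2⟩

theorem isR1_rareVacuum (hγ : 1 < γ) (h₀ : U₀.IsGas) : IsR1 γ (rareVacuum γ U₀) U₀ := by
  refine ⟨h₀, Or.inr (rareVacuum_isVacuum h₀), rfl, ?_, ?_, h₀.2.1⟩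
  · simp [rareVacuum, Real.zero_rpow (by linarith : γ ≠ 0)]
  · rw [(rareVacuum_isVacuum h₀).c_eq_zero]
    simp only [rareVacuum]
    ring

/-! ### Shock waves -/

/-- The mass flux through the backward shock from `U₀` to the pressure `p`. -/
noncomputable def shockFlux (γ : ℝ) (U₀ : State) (p : ℝ) : ℝ :=
  √(U₀.ρ * ((γ + 1) * p + (γ - 1) * U₀.p) / 2)

/-- The velocity at pressure `p` on the backward shock curve of `U₀`. -/
noncomputable def shockVelocity (γ : ℝ) (U₀ : State) (p : ℝ) : ℝ :=
  U₀.u - (p - U₀.p) / shockFlux γ U₀ p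

/-- The state of pressure `p` on the backward shock curve of `U₀`. -/
noncomputable def shockState (γ : ℝ) (U₀ : State) (p : ℝ) : State :=
  ⟨U₀.ρ * (((γ + 1) * p + (γ - 1) * U₀.p) / ((γ - 1) * p + (γ + 1) * U₀.p)),
    shockVelocity γ U₀ p, p, U₀.a⟩

/-- The speed of the backward shock from `U₀` to the pressure `p`. -/
noncomputable def shockSpeed (γ : ℝ) (U₀ : State) (p : ℝ) : ℝ :=
  U₀.u - shockFlux γ U₀ p / U₀.ρ

theorem shockFlux_pos (hγ : 1 < γ) (h₀ : U₀.IsGas) {p : ℝ} (hp : 0 ≤ p) :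
    0 < shockFlux γ U₀ p := by
  have h1 := h₀.1
  have h2 := mul_pos (sub_pos.2 hγ) h₀.2.1
  have h3 : 0 ≤ (γ + 1) * p := mul_nonneg (by linarith) hp
  exact Real.sqrt_pos.2 (div_pos (mul_pos h1 (by linarith)) two_pos)

theorem shockFlux_sq (hγ : 1 < γ) (h₀ : U₀.IsGas) {p : ℝ} (hp : 0 ≤ p) :
    shockFlux γ U₀ p ^ 2 = U₀.ρ * ((γ + 1) * p + (γ - 1) * U₀.p) / 2 :=
  Real.sq_sqrt (Real.sqrt_pos.1 (shockFlux_pos hγ h₀ hp)).le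

theorem shockState_isGas (hγ : 1 < γ) (h₀ : U₀.IsGas) {p : ℝ} (hp : 0 < p) :
    (shockState γ U₀ p).IsGas := by
  have h1 := h₀.1
  have h2 := h₀.2.1
  have h3 : 0 < γ - 1 := by linarith
  have h4 : 0 < γ + 1 := by linarith
  exact ⟨by simp only [shockState]; positivity, hp, h₀.2.2⟩

/-- Given conservation of mass and momentum, the energy balance across a discontinuity, in the frame
of the discontinuity. -/
theorem energy_balance (hγ : 1 < γ) (hU : U.ρ ≠ 0) (h₀ : U₀.ρ ≠ 0) {j : ℝ}
    (hm : U.ρ * (U.u - σ) = j) (hm₀ : U₀.ρ * (U₀.u - σ) = j)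
    (hmom : U.p + j * (U.u - σ) = U₀.p + j * (U₀.u - σ)) :
    2 * (γ - 1) * (-σ * (U.ρ * U.E γ - U₀.ρ * U₀.E γ)
      + (U.u * (U.ρ * U.E γ + U.p) - U₀.u * (U₀.ρ * U₀.E γ + U₀.p))) =
    (U.u - σ) * ((γ + 1) * U.p + (γ - 1) * U₀.p)
      - (U₀.u - σ) * ((γ - 1) * U.p + (γ + 1) * U₀.p) := by
  have h1 : γ - 1 ≠ 0 := by linarith
  have hE : ∀ W : State, W.ρ ≠ 0 → (γ - 1) * (W.ρ * W.E γ) = W.p + (γ - 1) * W.ρ * W.u ^ 2 / 2 := by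
    intro W hW
    unfold State.E
    field_simp
  linear_combination 2 * (U.u - σ) * hE U hU - 2 * (U₀.u - σ) * hE U₀ h₀
    + (γ - 1) * U.u ^ 2 * hm - (γ - 1) * U₀.u ^ 2 * hm₀ + (γ - 1) * (U.u + U₀.u) * hmom

/-- In the frame of the shock the mass flux is `j` on both sides and the energy relation becomes `v
A = v₀ B`. The Lax condition follows from `ρ v² = B / 2 < γ p` and `ρ₀ v₀² = A / 2 > γ p₀`, both
equivalent to `p₀ < p`. -/
theorem isS1_shockState (hγ : 1 < γ) (h₀ : U₀.IsGas) {p : ℝ} (hp : U₀.p < p) :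
    IsS1 γ (shockSpeed γ U₀ p) (shockState γ U₀ p) U₀ := by
  have hρ₀ := h₀.1
  have hp₀ := h₀.2.1
  have h3 : 0 < γ - 1 := by linarith
  have h4 : 0 < γ + 1 := by linarith
  have hp0 : 0 < p := hp₀.trans hp
  have hj := shockFlux_pos hγ h₀ hp0.le
  have hj2 := shockFlux_sq hγ h₀ hp0.le
  set j := shockFlux γ U₀ p with hj_def
  have hA : 0 < (γ + 1) * p + (γ - 1) * U₀.p := by positivity
  have hB : 0 < (γ - 1) * p + (γ + 1) * U₀.p := by positivity
  set A := (γ + 1) * p + (γ - 1) * U₀.p with hA_def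
  set B := (γ - 1) * p + (γ + 1) * U₀.p with hB_def
  have hG := shockState_isGas hγ h₀ hp0
  have hpj : (p - U₀.p) / j = j / U₀.ρ - j * B / (U₀.ρ * A) := by
    have : p - U₀.p = (A - B) / 2 := by rw [hA_def, hB_def]; ring
    rw [this]
    field_simp
    rw [hj2]
    field_simp
  have hv : shockVelocity γ U₀ p - shockSpeed γ U₀ p = j * B / (U₀.ρ * A) := by
    unfold shockVelocity shockSpeed
    rw [← hj_def, hpj]
    ring
  have hmass : (shockState γ U₀ p).ρ * (shockVelocity γ U₀ p - shockSpeed γ U₀ p) = j := by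
    rw [hv]
    simp only [shockState]
    rw [← hA_def, ← hB_def]
    field_simp
  have hmass₀ : U₀.ρ * (U₀.u - shockSpeed γ U₀ p) = j := by
    unfold shockSpeed
    rw [← hj_def]
    field_simp
    ring
  have hmom : p + j * (shockVelocity γ U₀ p - shockSpeed γ U₀ p) =
      U₀.p + j * (U₀.u - shockSpeed γ U₀ p) := by
    have : shockVelocity γ U₀ p = U₀.u - (p - U₀.p) / j := rfl
    rw [this]
    field_simp
    ring
  have hprod : (shockVelocity γ U₀ p - shockSpeed γ U₀ p) * A
      = (U₀.u - shockSpeed γ U₀ p) * B := by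
    have : U₀.u - shockSpeed γ U₀ p = j / U₀.ρ := by unfold shockSpeed; rw [← hj_def]; ring
    rw [hv, this]
    field_simp
  have hE := energy_balance hγ hG.1.ne' hρ₀.ne' hmass hmass₀ hmom
  have hu : (shockState γ U₀ p).u = shockVelocity γ U₀ p := rfl
  have hp' : (shockState γ U₀ p).p = p := rfl
  have hc₀ := h₀.rho_mul_c_sq hγ
  have hc := hG.rho_mul_c_sq hγ
  rw [hp'] at hc
  refine ⟨h₀, hG, ⟨rfl, ?_, ?_, ?_⟩, ?_, ?_⟩
  · rw [hu]
    linarith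
  · rw [hu, hp']
    linear_combination shockVelocity γ U₀ p * hmass - U₀.u * hmass₀ + hmom
  · rw [hu, hp', ← hA_def, ← hB_def, hprod, sub_self] at hE
    rw [hu, hp']
    exact (mul_eq_zero.1 hE).resolve_left (by positivity)
  · have h5 : (shockState γ U₀ p).ρ * (shockVelocity γ U₀ p - shockSpeed γ U₀ p) ^ 2 = B / 2 := by
      rw [pow_two, ← mul_assoc, hmass, hv]
      field_simp
      linarith
    have h6 : (shockState γ U₀ p).ρ * (shockVelocity γ U₀ p - shockSpeed γ U₀ p) ^ 2
        < (shockState γ U₀ p).ρ * (shockState γ U₀ p).c γ ^ 2 := by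
      rw [h5, hc, hB_def]
      nlinarith
    have h7 := lt_of_pow_lt_pow_left₀ 2 (hG.c_pos hγ).le (lt_of_mul_lt_mul_left h6 hG.1.le)
    unfold lam1
    rw [hu]
    linarith
  · have h5 : U₀.ρ * (U₀.u - shockSpeed γ U₀ p) ^ 2 = A / 2 := by
      rw [pow_two, ← mul_assoc, hmass₀]
      unfold shockSpeed
      rw [← hj_def]
      field_simp
      rw [sub_sub_cancel]
      linarith
    have h6 : U₀.ρ * U₀.c γ ^ 2 < U₀.ρ * (U₀.u - shockSpeed γ U₀ p) ^ 2 := by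
      rw [h5, hc₀, hA_def]
      nlinarith
    have h7 := lt_of_pow_lt_pow_left₀ 2
      (by unfold shockSpeed; rw [sub_sub_cancel]; positivity)
      (lt_of_mul_lt_mul_left h6 hρ₀.le)
    unfold lam1
    linarith

theorem IsS1.spec (hγ : 1 < γ) (h : IsS1 γ σ U U₀) :
    U₀.p < U.p ∧ U = shockState γ U₀ U.p ∧ σ = shockSpeed γ U₀ U.p := by
  obtain ⟨h₀, hG, ⟨ha, h1, h2, h3⟩, h4, h5⟩ := h
  unfold lam1 at h4 h5
  have hc₀ := h₀.c_pos hγ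
  have hv₀ : 0 < U₀.u - σ := hc₀.trans (by linarith)
  obtain ⟨j, hm₀⟩ : ∃ j, U₀.ρ * (U₀.u - σ) = j := ⟨_, rfl⟩
  have hm : U.ρ * (U.u - σ) = j := by linarith
  have hj : 0 < j := hm₀ ▸ mul_pos h₀.1 hv₀
  have hv : 0 < U.u - σ := pos_of_mul_pos_right (hm ▸ hj) hG.1.le
  have hmom : U.p + j * (U.u - σ) = U₀.p + j * (U₀.u - σ) := by
    linear_combination h2 - U.u * hm + U₀.u * hm₀
  have hE := energy_balance hγ hG.1.ne' h₀.1.ne' hm hm₀ hmom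
  rw [h3, mul_zero] at hE
  have hρ₀ := h₀.1
  have hp₀ := h₀.2.1
  have hρ := hG.1
  have hp := hG.2.1
  have hγ1 : 0 < γ - 1 := by linarith
  have hγ2 : 0 < γ + 1 := by linarith
  have hA : 0 < (γ + 1) * U.p + (γ - 1) * U₀.p := by positivity
  have hB : 0 < (γ - 1) * U.p + (γ + 1) * U₀.p := by positivity
  -- Without a pressure jump the two states would have equal velocity and sound speed, contradicting
  -- the Lax condition.
  have hpne : U.p - U₀.p ≠ 0 := by
    intro hpp
    have h6 : j * (U.u - U₀.u) = 0 := by linarith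
    have hu : U.u = U₀.u := by linarith [(mul_eq_zero.1 h6).resolve_left hj.ne']
    have hρρ : U.ρ = U₀.ρ := by
      rw [hu, ← hm₀] at hm
      exact mul_right_cancel₀ hv₀.ne' hm
    have : U.c γ = U₀.c γ := by
      unfold State.c
      rw [hρρ, sub_eq_zero.1 hpp]
    linarith
  -- Eliminating the velocity behind the shock leaves a common factor, the pressure jump, which may
  -- be cancelled.
  have hjv : j * (U₀.u - σ) = ((γ + 1) * U.p + (γ - 1) * U₀.p) / 2 := by
    have h6 : (U.p - U₀.p) * (j * (U₀.u - σ)) =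
        (U.p - U₀.p) * (((γ + 1) * U.p + (γ - 1) * U₀.p) / 2) := by
      linear_combination (-j / 2) * hE
        - ((γ + 1) * U.p + (γ - 1) * U₀.p) / 2 * hmom
    exact mul_left_cancel₀ hpne h6
  have hj2 : j ^ 2 = U₀.ρ * ((γ + 1) * U.p + (γ - 1) * U₀.p) / 2 := by
    linear_combination U₀.ρ * hjv - j * hm₀
  have hjeq : shockFlux γ U₀ U.p = j := by
    unfold shockFlux
    rw [← hj2, Real.sqrt_sq hj.le]
  refine ⟨?_, State.ext ?_ ?_ rfl ha, ?_⟩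
  · have h6 : U₀.c γ ^ 2 < (U₀.u - σ) ^ 2 := pow_lt_pow_left₀ (by linarith) hc₀.le two_ne_zero
    have h7 := mul_lt_mul_of_pos_left h6 hρ₀
    rw [h₀.rho_mul_c_sq hγ, pow_two, ← mul_assoc, hm₀, hjv] at h7
    nlinarith
  · simp only [shockState]
    rw [mul_div_assoc', eq_div_iff hB.ne']
    have h6 : U.ρ * (U.u - σ) * (U₀.u - σ) * ((γ - 1) * U.p + (γ + 1) * U₀.p) =
        U₀.ρ * (U₀.u - σ) * (U.u - σ) * ((γ + 1) * U.p + (γ - 1) * U₀.p) := by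
      rw [hm, hm₀]
      linear_combination j * hE
    refine mul_left_cancel₀ (mul_pos hv hv₀).ne' ?_
    linear_combination h6
  · simp only [shockState, shockVelocity]
    rw [hjeq]
    field_simp
    linarith
  · unfold shockSpeed
    rw [hjeq, ← hm₀, mul_div_cancel_left₀ _ hρ₀.ne']
    ring

theorem IsS1.speed_lt_velocity (hγ : 1 < γ) (h : IsS1 γ σ U U₀) : σ < U.u := by
  obtain ⟨h₀, hG, ⟨-, h1, -, -⟩, -, h5⟩ := h
  unfold lam1 at h5
  have hv₀ : 0 < U₀.u - σ := (h₀.c_pos hγ).trans (by linarith)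
  have hm : 0 < U.ρ * (U.u - σ) := by linarith [mul_pos h₀.1 hv₀]
  linarith [pos_of_mul_pos_right hm hG.1.le]

theorem shockVelocity_self (γ : ℝ) (U₀ : State) : shockVelocity γ U₀ U₀.p = U₀.u := by
  simp [shockVelocity]

theorem continuousOn_shockVelocity (hγ : 1 < γ) (h₀ : U₀.IsGas) :
    ContinuousOn (shockVelocity γ U₀) (Ici 0) := by
  have h : Continuous (shockFlux γ U₀) := by
    unfold shockFlux
    fun_prop
  unfold shockVelocity
  exact continuousOn_const.sub ((continuous_id.sub continuous_const).continuousOn.div h.continuousOn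
    fun p hp => (shockFlux_pos hγ h₀ hp).ne')

theorem shockFlux_lt_shockFlux (hγ : 1 < γ) (h₀ : U₀.IsGas) {p q : ℝ} (hp : 0 ≤ p) (hpq : p < q) :
    shockFlux γ U₀ p < shockFlux γ U₀ q := by
  refine lt_of_pow_lt_pow_left₀ 2 (shockFlux_pos hγ h₀ (hp.trans hpq.le)).le ?_
  rw [shockFlux_sq hγ h₀ hp, shockFlux_sq hγ h₀ (hp.trans hpq.le)]
  have h1 : (γ + 1) * p < (γ + 1) * q := mul_lt_mul_of_pos_left hpq (by linarith)
  have h2 := mul_lt_mul_of_pos_left h1 h₀.1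
  linarith

theorem strictAntiOn_shockVelocity (hγ : 1 < γ) (h₀ : U₀.IsGas) :
    StrictAntiOn (shockVelocity γ U₀) (Ici U₀.p) := by
  intro p hp q hq hpq
  have hp0 : 0 < p := h₀.2.1.trans_le hp
  have hq0 : 0 < q := hp0.trans hpq
  have h1 := shockFlux_pos hγ h₀ hp0.le
  have h2 := shockFlux_pos hγ h₀ hq0.le
  have h3 : (p - U₀.p) / shockFlux γ U₀ p < (q - U₀.p) / shockFlux γ U₀ q := by
    rw [div_lt_div_iff₀ h1 h2]
    refine lt_of_pow_lt_pow_left₀ 2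
      (mul_nonneg (sub_nonneg.2 (mem_Ici.1 hq)) h1.le) ?_
    rw [mul_pow, mul_pow, shockFlux_sq hγ h₀ hp0.le, shockFlux_sq hγ h₀ hq0.le]
    have hx : 0 ≤ p - U₀.p := sub_nonneg.2 hp
    have hp₀ := h₀.2.1
    obtain ⟨x, hxp⟩ : ∃ x, x = p - U₀.p := ⟨_, rfl⟩
    obtain ⟨y, hyp⟩ : ∃ y, y = q - U₀.p := ⟨_, rfl⟩
    have hpx : p = x + U₀.p := by linarith
    have hqy : q = y + U₀.p := by linarith
    have hxy : x < y := by linarith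
    have hx0 : 0 ≤ x := by linarith
    rw [hpx, hqy]
    -- This is the difference of the two squared sides, written in the excess pressures `x` and `y`.
    have hpos : 0 < U₀.ρ / 2 * ((y - x) * ((γ + 1) * x * y + 2 * γ * U₀.p * (x + y))) := by
      have h4 : 0 < y - x := by linarith
      have h5 : 0 < y := by linarith
      have h6 := h₀.1
      have h7 : 0 < γ := by linarith
      positivity
    nlinarith
  unfold shockVelocity
  linarith

end Duct

namespace Duct

open Set State

variable {γ : ℝ} {U V W : State}

/-! ### Stationary waves -/

/-- Translates the entropy condition: the cross-section is monotone exactly opposite to the flux. -/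
theorem stationaryArea_mul (hγ : 1 < γ) (hU : U.IsGas) {r : ℝ} (hr : 0 < r) :
    stationaryArea γ U (U.ρ * r) =
      U.a * |U.u| / √(stationaryFlux γ U.u (U.c γ ^ 2) r) := by
  have hρ := hU.1
  have h1 : U.kappa γ * U.ρ ^ (γ - 1) = U.p / U.ρ := by
    have := (Real.rpow_pos_of_pos hρ γ).ne'
    unfold kappa
    rw [Real.rpow_sub_one hρ.ne']
    field_simp
  have h2 : U.u ^ 2 + 2 * (U.kappa γ * γ / (γ - 1)) * (U.ρ ^ (γ - 1) - (U.ρ * r) ^ (γ - 1)) =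
      U.u ^ 2 + 2 * U.c γ ^ 2 / (γ - 1) * (1 - r ^ (γ - 1)) := by
    rw [Real.mul_rpow hρ.le hr.le, hU.c_sq hγ]
    have h3 : γ * U.p / U.ρ = γ * (U.kappa γ * U.ρ ^ (γ - 1)) := by rw [h1, mul_div_assoc]
    rw [h3]
    ring
  unfold stationaryArea stationaryFlux
  rw [h2, Real.sqrt_mul (sq_nonneg r), Real.sqrt_sq hr.le, mul_right_comm U.a, mul_comm _ U.ρ,
    mul_assoc U.ρ r, mul_div_mul_left _ _ hρ.ne']

theorem Supersonic.u_pos (hγ : 1 < γ) (hU : U.IsGas) (hs : U.Supersonic γ) : 0 < U.u :=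
  (hU.c_pos hγ).trans hs

theorem Supersonic.c_sq_lt (hγ : 1 < γ) (hU : U.IsGas) (hs : U.Supersonic γ) :
    U.c γ ^ 2 < U.u ^ 2 :=
  pow_lt_pow_left₀ hs (hU.c_pos hγ).le two_ne_zero

theorem stationary_pressure (hU : U.IsGas) {r : ℝ} (hr : 0 < r)
    (hρ : V.ρ = U.ρ * r) : U.kappa γ = V.kappa γ ↔ V.p = U.p * r ^ γ := by
  have h1 := (Real.rpow_pos_of_pos hU.1 γ).ne'
  have h2 := (Real.rpow_pos_of_pos hr γ).ne'
  unfold kappa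
  rw [hρ, Real.mul_rpow hU.1.le hr.le, div_eq_div_iff h1 (mul_ne_zero h1 h2), ← mul_assoc,
    mul_right_comm, mul_right_cancel_iff_of_pos (Real.rpow_pos_of_pos hU.1 γ)]
  exact eq_comm

theorem stationary_c_sq (hγ : 1 < γ) (hU : U.IsGas) (hV : V.IsGas) {r : ℝ} (hr : 0 < r)
    (hρ : V.ρ = U.ρ * r) (hp : V.p = U.p * r ^ γ) : V.c γ ^ 2 = U.c γ ^ 2 * r ^ (γ - 1) := by
  have := hU.1.ne'
  rw [hU.c_sq hγ, hV.c_sq hγ, hρ, hp, Real.rpow_sub_one hr.ne']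
  field_simp

/-- A stationary wave from a supersonic state into a wider duct, in terms of the density
ratio `r`. -/
structure Expansion (γ : ℝ) (U V : State) (r : ℝ) : Prop where
  mem : r ∈ Ioo (0 : ℝ) 1
  rho : V.ρ = U.ρ * r
  p : V.p = U.p * r ^ γ
  u : V.u = U.a / V.a * U.u / r
  flux : stationaryFlux γ U.u (U.c γ ^ 2) r = (U.a / V.a * U.u) ^ 2

/-- The conservation laws alone do not force `r < 1`; this comes from the entropy condition. The
area must grow from `U.a` to `V.a`, yet just above `r = 1` the flux still increases, so the area
falls there. -/
theorem IsS0.exists_expansion (hγ : 1 < γ) (h : IsS0 γ V U) (hs : U.Supersonic γ)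
    (ha : U.a < V.a) : ∃ r, Expansion γ U V r := by
  obtain ⟨hU, hV, -, hm, he, hκ, hmono⟩ := h
  have hu := Supersonic.u_pos hγ hU hs
  have hρ := hU.1
  have hρV := hV.1
  have haU := hU.2.2
  have haV := hV.2.2
  set r := V.ρ / U.ρ with hr_def
  have hr : 0 < r := div_pos hρV hρ
  have hρr : V.ρ = U.ρ * r := by rw [hr_def, mul_div_cancel₀ _ hρ.ne']
  have hp : V.p = U.p * r ^ γ := (stationary_pressure hU hr hρr).1 hκ
  have hVu : V.u = U.a / V.a * U.u / r := by
    rw [hρr] at hm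
    field_simp
    refine mul_left_cancel₀ hρ.ne' ?_
    linear_combination -hm
  have hflux : stationaryFlux γ U.u (U.c γ ^ 2) r = (U.a / V.a * U.u) ^ 2 := by
    have h1 : U.a / V.a * U.u = r * V.u := by rw [hVu]; field_simp
    rw [h1, mul_pow]
    unfold stationaryFlux
    congr 1
    rw [stationary_c_sq hγ hU hV hr hρr hp] at he
    linear_combination 2 * he
  have hsq := Supersonic.c_sq_lt hγ hU hs
  have hc2 : 0 < U.c γ ^ 2 := pow_pos (hU.c_pos hγ) 2
  have hareaV : stationaryArea γ U V.ρ = V.a := by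
    rw [hρr, stationaryArea_mul hγ hU hr, hflux, Real.sqrt_sq (by positivity), abs_of_pos hu]
    field_simp
  have hareaU : stationaryArea γ U U.ρ = U.a := by
    have := stationaryArea_mul hγ hU one_pos
    rw [mul_one, stationaryFlux_one, Real.sqrt_sq hu.le, abs_of_pos hu,
      mul_div_cancel_right₀ _ hu.ne'] at this
    exact this
  refine ⟨r, ⟨hr, ?_⟩, hρr, hp, hVu, hflux⟩
  by_contra hr1
  rw [not_lt] at hr1
  have hle : U.ρ ≤ V.ρ := by rw [hρr]; nlinarith
  rw [uIcc_of_le hle] at hmono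
  rcases hmono with hmono | hmono
  · obtain ⟨R, hR1, hR⟩ := exists_strictMonoOn_stationaryFlux hγ hc2 hsq
    rcases hr1.eq_or_lt with h1 | h1
    · rw [hρr, ← h1, mul_one, hareaU] at hareaV
      exact ha.ne hareaV
    -- The point `q` lies both inside the wave and on the branch where the flux increases.
    · set q := min r R
      have hq1 : 1 < q := lt_min h1 hR1
      have hfl : U.u ^ 2 < stationaryFlux γ U.u (U.c γ ^ 2) q := by
        rw [← stationaryFlux_one γ U.u (U.c γ ^ 2)]
        exact hR ⟨zero_le_one, hR1.le⟩ ⟨by linarith, min_le_right _ _⟩ hq1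
      have hm1 : stationaryArea γ U U.ρ ≤ stationaryArea γ U (U.ρ * q) := by
        refine hmono ⟨le_rfl, hle⟩ ⟨by nlinarith, ?_⟩ (by nlinarith)
        rw [hρr]
        exact mul_le_mul_of_nonneg_left (min_le_left _ _) hρ.le
      rw [hareaU, stationaryArea_mul hγ hU (by linarith), abs_of_pos hu] at hm1
      have h2 : U.u < √(stationaryFlux γ U.u (U.c γ ^ 2) q) := by
        exact Real.lt_sqrt_of_sq_lt hfl
      rw [le_div_iff₀ (hu.trans h2)] at hm1
      nlinarith
  · have := hmono ⟨le_rfl, hle⟩ ⟨hle, le_rfl⟩ hle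
    rw [hareaU, hareaV] at this
    linarith

namespace Expansion

variable {r : ℝ}

theorem u_sq (hγ : 1 < γ) (h : Expansion γ U V r) (hU : U.IsGas) (hV : V.IsGas) :
    (γ - 1) * V.u ^ 2 + 2 * V.c γ ^ 2 = (γ - 1) * U.u ^ 2 + 2 * U.c γ ^ 2 := by
  have hr := h.mem.1
  have h0 : γ - 1 ≠ 0 := by linarith
  have h1 : V.u ^ 2 = U.u ^ 2 + 2 * U.c γ ^ 2 / (γ - 1) * (1 - r ^ (γ - 1)) := by
    have := h.flux
    rw [h.u, div_pow, ← this]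
    unfold stationaryFlux
    field_simp
  rw [h1, stationary_c_sq hγ hU hV hr h.rho h.p]
  field_simp
  ring

theorem c_lt (hγ : 1 < γ) (h : Expansion γ U V r) (hU : U.IsGas) (hV : V.IsGas) :
    V.c γ ^ 2 < U.c γ ^ 2 := by
  rw [stationary_c_sq hγ hU hV h.mem.1 h.rho h.p]
  exact mul_lt_of_lt_one_right (pow_pos (hU.c_pos hγ) 2)
    (Real.rpow_lt_one h.mem.1.le h.mem.2 (by linarith))

theorem u_pos (hγ : 1 < γ) (h : Expansion γ U V r) (hU : U.IsGas) (hV : V.IsGas)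
    (hs : U.Supersonic γ) : 0 < V.u := by
  rw [h.u]
  exact div_pos (mul_pos (div_pos hU.2.2 hV.2.2) (Supersonic.u_pos hγ hU hs)) h.mem.1

/-- By Bernoulli's law the loss in sound speed is a gain in velocity. -/
theorem u_lt (hγ : 1 < γ) (h : Expansion γ U V r) (hU : U.IsGas) (hV : V.IsGas)
    (hs : U.Supersonic γ) : U.u < V.u := by
  refine lt_of_pow_lt_pow_left₀ 2 (h.u_pos hγ hU hV hs).le ?_
  nlinarith [h.u_sq hγ hU hV, h.c_lt hγ hU hV]

theorem supersonic (hγ : 1 < γ) (h : Expansion γ U V r) (hU : U.IsGas) (hV : V.IsGas)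
    (hs : U.Supersonic γ) : V.Supersonic γ := by
  have h1 := h.u_lt hγ hU hV hs
  have h2 := lt_of_pow_lt_pow_left₀ 2 (hU.c_pos hγ).le (h.c_lt hγ hU hV)
  exact (h2.trans hs).trans h1

theorem isS0 (hγ : 1 < γ) (h : Expansion γ U V r) (hU : U.IsGas) (hV : V.IsGas)
    (hs : U.Supersonic γ) (ha : U.a < V.a) : IsS0 γ V U := by
  have hr := h.mem.1
  have hρ := hU.1
  have h0 : γ - 1 ≠ 0 := by linarith
  have hu := Supersonic.u_pos hγ hU hs
  refine ⟨hU, hV, ha.ne', ?_, ?_, (stationary_pressure hU hr h.rho).2 h.p, Or.inr ?_⟩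
  · have := hV.2.2
    rw [h.rho, h.u]
    field_simp
  · have := h.u_sq hγ hU hV
    field_simp
    linarith
  · have hle : V.ρ ≤ U.ρ := by
      rw [h.rho]
      exact mul_le_of_le_one_right hρ.le h.mem.2.le
    rw [uIcc_of_ge hle]
    have hmono := strictMonoOn_stationaryFlux_unit hγ (pow_pos (hU.c_pos hγ) 2)
      (Supersonic.c_sq_lt hγ hU hs)
    intro x hx y hy hxy
    have hx0 : 0 < x := hV.1.trans_le hx.1
    have hy0 : 0 < y := hx0.trans_le hxy
    have key : ∀ z : ℝ, z = U.ρ * (z / U.ρ) := fun z => by field_simp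
    rw [key x, key y, stationaryArea_mul hγ hU (div_pos hx0 hρ),
      stationaryArea_mul hγ hU (div_pos hy0 hρ)]
    have hmem : ∀ z, 0 < z → z ≤ U.ρ → z / U.ρ ∈ Icc (0 : ℝ) 1 := fun z hz hz' =>
      ⟨(div_pos hz hρ).le, (div_le_one hρ).2 hz'⟩
    have hx1 := hmem x hx0 hx.2
    have hpos : 0 < stationaryFlux γ U.u (U.c γ ^ 2) (x / U.ρ) := by
      have := hmono ⟨le_rfl, zero_le_one⟩ hx1 (div_pos hx0 hρ)
      simpa [stationaryFlux] using this
    refine div_le_div_of_nonneg_left (mul_nonneg hU.2.2.le (abs_nonneg _)) (Real.sqrt_pos.2 hpos)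
      (Real.sqrt_le_sqrt ?_)
    exact hmono.monotoneOn hx1 (hmem y hy0 hy.2) (div_le_div_of_nonneg_right hxy hρ.le)

theorem unique (hγ : 1 < γ) {s : ℝ} (hV : Expansion γ U V r) (hW : Expansion γ U W s)
    (hU : U.IsGas) (hs : U.Supersonic γ) (ha : V.a = W.a) : V = W := by
  have hrs : r = s := by
    refine (strictMonoOn_stationaryFlux_unit hγ (pow_pos (hU.c_pos hγ) 2)
      (Supersonic.c_sq_lt hγ hU hs)).injOn (Ioo_subset_Icc_self hV.mem)
      (Ioo_subset_Icc_self hW.mem) ?_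
    rw [hV.flux, hW.flux, ha]
  subst hrs
  exact State.ext (by rw [hV.rho, hW.rho]) (by rw [hV.u, hW.u, ha]) (by rw [hV.p, hW.p]) ha

end Expansion

/-- The required squared flux lies strictly between the values 0 at `r = 0` and `u²` at `r = 1`,
because the duct widens. -/
theorem exists_expansion (hγ : 1 < γ) (hU : U.IsGas) (hs : U.Supersonic γ) {b : ℝ}
    (hb : U.a < b) : ∃ V r, V.IsGas ∧ V.a = b ∧ Expansion γ U V r := by
  have hu := Supersonic.u_pos hγ hU hs
  have haU := hU.2.2
  have hb0 : 0 < b := haU.trans hb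
  have hq : U.a / b < 1 := (div_lt_one hb0).2 hb
  have hq0 : 0 < U.a / b := div_pos haU hb0
  have hmem : (U.a / b * U.u) ^ 2 ∈ Ioo (stationaryFlux γ U.u (U.c γ ^ 2) 0)
      (stationaryFlux γ U.u (U.c γ ^ 2) 1) := by
    rw [stationaryFlux_one]
    refine ⟨?_, ?_⟩
    · have : stationaryFlux γ U.u (U.c γ ^ 2) 0 = 0 := by simp [stationaryFlux]
      rw [this]
      positivity
    · exact pow_lt_pow_left₀ (mul_lt_of_lt_one_left hu hq) (by positivity) two_ne_zero
  obtain ⟨r, hr, hfr⟩ := intermediate_value_Ioo zero_le_one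
    (continuous_stationaryFlux hγ U.u (U.c γ ^ 2)).continuousOn hmem
  exact ⟨⟨U.ρ * r, U.a / b * U.u / r, U.p * r ^ γ, b⟩, r,
    ⟨mul_pos hU.1 hr.1, mul_pos hU.2.1 (Real.rpow_pos_of_pos hr.1 γ), hb0⟩, rfl,
    ⟨hr, rfl, rfl, rfl, hfr⟩⟩

end Duct

/-! ### Position of the right state relative to the wave curves of the left one. -/

namespace Duct

open Set State

variable {γ x r s : ℝ} {Uₗ Uₘ Us Uᵣ : State}

/-- The stationary waves give the velocity gain `u (1/x - 1)`. The rarefaction gives `c (1 - x ^ b)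
/ b` with `b = (γ - 1) / 2`, which is at most `c (1/x - 1)`, and `c < u`. -/
theorem rareVelocity_lt (hγ : 1 < γ) (h : Us.IsGas) (hs : Us.Supersonic γ) (hx : 0 < x)
    (hx1 : x < 1) (hp : Uᵣ.p = Us.p * x ^ γ) (hu : Uᵣ.u = Us.u / x) :
    rareVelocity γ Us Uᵣ.p < Uᵣ.u := by
  have hb : 0 < (γ - 1) / 2 := by linarith
  have h1 : (Uᵣ.p / Us.p) ^ ((γ - 1) / (2 * γ)) = x ^ ((γ - 1) / 2) := by
    rw [hp, mul_div_cancel_left₀ _ h.2.1.ne', ← Real.rpow_mul hx.le]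
    congr 1
    have : γ ≠ 0 := by linarith
    field_simp
  have h2 := one_sub_rpow_le hb hx
  have h3 : 0 < 1 / x - 1 := by linarith [(one_lt_one_div hx hx1)]
  have h4 : Us.c γ * ((1 - x ^ ((γ - 1) / 2)) / ((γ - 1) / 2)) ≤ Us.c γ * (1 / x - 1) :=
    mul_le_mul_of_nonneg_left h2 (h.c_pos hγ).le
  have h5 : Us.c γ * (1 / x - 1) < Us.u * (1 / x - 1) := mul_lt_mul_of_pos_right hs h3
  unfold rareVelocity
  rw [h1, hu]
  have h6 : Us.c γ * ((1 - x ^ ((γ - 1) / 2)) / ((γ - 1) / 2)) =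
      -(2 / (γ - 1) * (Us.c γ * x ^ ((γ - 1) / 2) - Us.c γ)) := by
    have : γ - 1 ≠ 0 := by linarith
    field_simp
    ring
  have h7 : Us.u * (1 / x - 1) = Us.u / x - Us.u := by ring
  linarith

/-- The claim is that the velocity drop across the shock is less than `u (1 - 1/x)`. Squaring and
using `ρ c² = γ p` turns it into `shock_velocity_estimate` combined with `hD`. -/
theorem lt_shockVelocity (hγ : 1 < γ) (h : Us.IsGas) (hs : Us.Supersonic γ) (hx : 1 < x)
    (hp : Uᵣ.p = Us.p * x ^ γ) (hu : Uᵣ.u = Us.u / x)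
    (hD : 2 * Us.c γ ^ 2 * x ^ 2 < ((γ + 1) - (γ - 1) * x ^ 2) * Us.u ^ 2) :
    Uᵣ.u < shockVelocity γ Us Uᵣ.p := by
  have hx0 : 0 < x := by linarith
  have hP : 1 < x ^ γ := Real.one_lt_rpow hx (by linarith)
  have hest := shock_velocity_estimate hγ hx hP (rpow_mul_le_of_one_le hγ hx.le) rfl
  have hpos : 0 < Uᵣ.p := by rw [hp]; exact mul_pos h.2.1 (by linarith)
  have hj := shockFlux_pos hγ h hpos.le
  have hj2 := shockFlux_sq hγ h hpos.le
  have hus := Supersonic.u_pos hγ h hs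
  have hc := h.rho_mul_c_sq hγ
  have hρ := h.1
  have hp₀ := h.2.1
  set P := x ^ γ
  have h1 : ((P - 1) * x * Us.p) ^ 2 < ((x - 1) * Us.u * shockFlux γ Us Uᵣ.p) ^ 2 := by
    rw [mul_pow _ (shockFlux γ Us Uᵣ.p), hj2, hp]
    have h2 : (P - 1) ^ 2 * (2 * Us.c γ ^ 2 * x ^ 2) <
        γ * (x - 1) ^ 2 * ((γ + 1) * P + (γ - 1)) * Us.u ^ 2 := by
      refine (mul_lt_mul_of_pos_left hD (pow_pos (sub_pos.2 hP) 2)).trans_le ?_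
      rw [← mul_assoc]
      exact mul_le_mul_of_nonneg_right hest (sq_nonneg _)
    have h3 := mul_lt_mul_of_pos_left h2 (mul_pos hρ hp₀)
    have h4 : Us.ρ * Us.p * ((P - 1) ^ 2 * (2 * Us.c γ ^ 2 * x ^ 2)) =
        2 * γ * ((P - 1) * x * Us.p) ^ 2 := by
      linear_combination 2 * Us.p * (P - 1) ^ 2 * x ^ 2 * hc
    rw [h4] at h3
    have h5 : Us.ρ * Us.p * (γ * (x - 1) ^ 2 * ((γ + 1) * P + (γ - 1)) * Us.u ^ 2) =
        2 * γ * (((x - 1) * Us.u) ^ 2 *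
          (Us.ρ * ((γ + 1) * (Us.p * P) + (γ - 1) * Us.p) / 2)) := by
      ring
    rw [h5] at h3
    exact lt_of_mul_lt_mul_left h3 (by linarith)
  have h2 := lt_of_pow_lt_pow_left₀ 2
    (mul_nonneg (mul_nonneg (by linarith) hus.le) hj.le) h1
  have h3 : (Uᵣ.p - Us.p) / shockFlux γ Us Uᵣ.p < Us.u - Us.u / x := by
    have : Us.u - Us.u / x = (x - 1) * Us.u / x := by field_simp
    have hpp : Uᵣ.p - Us.p = (P - 1) * Us.p := by rw [hp]; ring
    rw [this, div_lt_div_iff₀ hj hx0, hpp]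
    linarith
  unfold shockVelocity
  rw [hu]
  linarith

/-- The pressure behind the backward shock of speed zero. -/
noncomputable def standingPressure (γ : ℝ) (U : State) : ℝ :=
  (2 * U.ρ * U.u ^ 2 - (γ - 1) * U.p) / (γ + 1)

theorem lt_standingPressure (hγ : 1 < γ) (h : Us.IsGas) (hx : 1 < x)
    (hp : Uᵣ.p = Us.p * x ^ γ)
    (hD : 2 * Us.c γ ^ 2 * x ^ 2 < ((γ + 1) - (γ - 1) * x ^ 2) * Us.u ^ 2) :
    Uᵣ.p < standingPressure γ Us := by
  have hP : 1 < x ^ γ := Real.one_lt_rpow hx (by linarith)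
  have hest := shock_pressure_estimate hγ hx hP (rpow_mul_le_of_one_le hγ hx.le) rfl
  have hc := h.rho_mul_c_sq hγ
  have hρ := h.1
  have hp₀ := h.2.1
  unfold standingPressure
  rw [lt_div_iff₀ (by linarith), hp]
  set P := x ^ γ
  have hA : 0 < (γ + 1) * P + (γ - 1) := by nlinarith
  have h1 := mul_lt_mul_of_pos_left hD (mul_pos hρ hA)
  have h2 := mul_le_mul_of_nonneg_left hest (mul_nonneg hρ.le (sq_nonneg Us.u))
  have h3 : Us.ρ * ((γ + 1) * P + (γ - 1)) * (2 * Us.c γ ^ 2 * x ^ 2) =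
      2 * γ * x ^ 2 * (Us.p * ((γ + 1) * P + (γ - 1))) := by
    linear_combination 2 * x ^ 2 * ((γ + 1) * P + (γ - 1)) * hc
  rw [h3] at h1
  have h4 : 2 * γ * x ^ 2 * (Us.p * ((γ + 1) * P + (γ - 1))) <
      2 * γ * x ^ 2 * (2 * Us.ρ * Us.u ^ 2) := by linarith
  have h5 := lt_of_mul_lt_mul_left h4 (by have : 0 < γ := by linarith
                                          positivity)
  linarith

theorem shockFlux_standingPressure (hγ : 1 < γ) (h : Us.IsGas) (hu : 0 < Us.u) :
    shockFlux γ Us (standingPressure γ Us) = Us.ρ * Us.u := by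
  have : γ + 1 ≠ 0 := by linarith
  unfold shockFlux standingPressure
  rw [mul_div_cancel₀ _ this, ← Real.sqrt_sq (mul_pos h.1 hu).le]
  congr 1
  ring

/-- Prandtl's relation. The right-hand side is a Bernoulli constant, so it can be evaluated at the
state before the stationary wave. -/
theorem shockVelocity_standingPressure (hγ : 1 < γ) (h : Us.IsGas) (hu : 0 < Us.u) :
    (γ + 1) * (Us.u * shockVelocity γ Us (standingPressure γ Us)) =
      (γ - 1) * Us.u ^ 2 + 2 * Us.c γ ^ 2 := by
  have h0 : γ + 1 ≠ 0 := by linarith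
  have h1 := h.1.ne'
  unfold shockVelocity
  rw [shockFlux_standingPressure hγ h hu, h.c_sq hγ]
  unfold standingPressure
  field_simp
  ring

/-- Shock states at a common pressure on two shock curves, the second one starting from the higher
pressure and the lower entropy, have different densities. -/
theorem shockState_rho_lt (hγ : 1 < γ) {U W : State} (hU : U.IsGas) (hW : W.IsGas) {p : ℝ}
    (hUW : U.p < W.p) (hp : W.p < p) (hκ : W.kappa γ < U.kappa γ) :
    (shockState γ U p).ρ < (shockState γ W p).ρ := by
  have hp0 : 0 < p := hW.2.1.trans hp
  have hlog : ∀ V : State, V.IsGas →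
      γ * Real.log (shockState γ V p).ρ =
        shockEntropy γ (p / V.p) + Real.log p - Real.log (V.kappa γ) := by
    intro V hV
    have h1 := hV.1
    have h2 := hV.2.1
    have h3 : 0 < γ - 1 := by linarith
    have h4 : 0 < γ + 1 := by linarith
    have hA : (γ + 1) * p + (γ - 1) * V.p = V.p * ((γ + 1) * (p / V.p) + (γ - 1)) := by
      field_simp
    have hB : (γ - 1) * p + (γ + 1) * V.p = V.p * ((γ - 1) * (p / V.p) + (γ + 1)) := by
      field_simp
    simp only [shockState, shockEntropy, kappa]
    rw [hA, hB, mul_div_mul_left _ _ h2.ne',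
      Real.log_mul h1.ne' (by positivity), Real.log_div (by positivity) (by positivity),
      Real.log_div h2.ne' (by positivity), Real.log_rpow h1, Real.log_div hp0.ne' h2.ne']
    ring
  have hκW : 0 < W.kappa γ := div_pos hW.2.1 (Real.rpow_pos_of_pos hW.1 γ)
  have h1 := Real.log_lt_log hκW hκ
  have h2 : p / W.p < p / U.p := div_lt_div_of_pos_left hp0 hU.2.1 hUW
  have h3 : 1 < p / W.p := (one_lt_div hW.2.1).2 hp
  have h4 := strictAntiOn_shockEntropy hγ (mem_Ici.2 h3.le) (mem_Ici.2 (h3.trans h2).le) h2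
  have h5 : γ * Real.log (shockState γ U p).ρ < γ * Real.log (shockState γ W p).ρ := by
    rw [hlog U hU, hlog W hW]
    linarith
  exact (Real.log_lt_log_iff (shockState_isGas hγ hU hp0).1 (shockState_isGas hγ hW hp0).1).1
    (lt_of_mul_lt_mul_left h5 (by linarith))

/-- On an isentrope `ρ ^ γ = p / κ`. The strict inequality ensures that the contact discontinuity in
the rarefaction fan is genuine. -/
theorem rareState_rho_lt (hγ : 1 < γ) {U W : State} (hU : U.IsGas) (hW : W.IsGas) {p : ℝ}
    (hp : 0 < p) (hκ : U.kappa γ < W.kappa γ) :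
    (rareState γ W p).ρ < (rareState γ U p).ρ := by
  have hlog : ∀ V : State, V.IsGas →
      γ * Real.log (rareState γ V p).ρ = Real.log p - Real.log (V.kappa γ) := by
    intro V hV
    have h1 := hV.1
    have h2 := hV.2.1
    have h3 : γ ≠ 0 := by linarith
    simp only [rareState, kappa]
    rw [Real.log_mul h1.ne' (by positivity), Real.log_rpow (by positivity),
      Real.log_div h2.ne' (by positivity), Real.log_rpow h1, Real.log_div hp.ne' h2.ne']
    field_simp
    ring
  have hκU : 0 < U.kappa γ := div_pos hU.2.1 (Real.rpow_pos_of_pos hU.1 γ)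
  have h1 := Real.log_lt_log hκU hκ
  have h5 : γ * Real.log (rareState γ W p).ρ < γ * Real.log (rareState γ U p).ρ := by
    rw [hlog U hU, hlog W hW]
    linarith
  exact (Real.log_lt_log_iff (rareState_isGas hW hp).1 (rareState_isGas hU hp).1).1
    (lt_of_mul_lt_mul_left h5 (by linarith))

theorem kappa_lt_kappa {U V : State} (hU : U.IsGas) (hγ : 1 < γ) (hp : U.p = V.p)
    (h : U.ρ < V.ρ) : V.kappa γ < U.kappa γ := by
  unfold kappa
  rw [hp]
  exact div_lt_div_of_pos_left (hp ▸ hU.2.1) (Real.rpow_pos_of_pos hU.1 γ)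
    (Real.rpow_lt_rpow hU.1.le h (by linarith))

theorem c_sq_lt_c_sq {U V : State} (hU : U.IsGas) (hV : V.IsGas) (hγ : 1 < γ) (hp : U.p = V.p)
    (h : U.ρ < V.ρ) : V.c γ ^ 2 < U.c γ ^ 2 := by
  rw [hU.c_sq hγ, hV.c_sq hγ, hp]
  exact div_lt_div_of_pos_left (mul_pos (by linarith) hV.2.1) hU.1 h

end Duct

/-! ### Comparison of the two expansions and construction of the fans. -/

namespace Duct

open Set State

variable {γ r s : ℝ} {Uₗ Uₘ Us Uᵣ : State}

/-- The pressure and velocity ratios of the states behind two expansions that start from the same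
pressure and velocity. -/
theorem Expansion.ratio (hs : Expansion γ Uₗ Us r) (hr : Expansion γ Uₘ Uᵣ s)
    (hu : Uₘ.u = Uₗ.u) (hp : Uₘ.p = Uₗ.p) (ha : Uₘ.a = Uₗ.a) (hb : Us.a = Uᵣ.a) :
    Uᵣ.p = Us.p * (s / r) ^ γ ∧ Uᵣ.u = Us.u / (s / r) := by
  have h1 := hs.mem.1
  have h2 := hr.mem.1
  have := (Real.rpow_pos_of_pos h1 γ).ne'
  constructor
  · rw [hr.p, hs.p, hp, Real.div_rpow h2.le h1.le]
    field_simp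
  · rw [hr.u, hs.u, hu, ha, hb]
    field_simp

theorem Expansion.rareVelocity_lt (hγ : 1 < γ) (hs : Expansion γ Uₗ Us r)
    (hr : Expansion γ Uₘ Uᵣ s) (hJ : IsJ Uₘ Uₗ) (hl : Uₗ.Supersonic γ) (hUs : Us.IsGas)
    (hb : Us.a = Uᵣ.a) (hρ : Uₘ.ρ < Uₗ.ρ) :
    Uᵣ.p < Us.p ∧ rareVelocity γ Us Uᵣ.p < Uᵣ.u := by
  obtain ⟨hL, hM, ha, hu, hp, -⟩ := hJ
  have hc := c_sq_lt_c_sq hM hL hγ hp hρ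
  have hsr : s < r := by
    refine lt_of_stationaryFlux_eq hγ (pow_pos (hL.c_pos hγ) 2) hc
      (Supersonic.c_sq_lt hγ hL hl) hs.mem hr.mem ?_
    rw [← hu, hr.flux, hu, hs.flux, ha, hb]
  obtain ⟨h1, h2⟩ := hs.ratio hr hu hp ha hb
  have hx : 0 < s / r := div_pos hr.mem.1 hs.mem.1
  have hx1 : s / r < 1 := (div_lt_one hs.mem.1).2 hsr
  refine ⟨?_, Duct.rareVelocity_lt hγ hUs (hs.supersonic hγ hL hUs hl) hx hx1 h1 h2⟩
  rw [h1]
  exact mul_lt_of_lt_one_right hUs.2.1 (Real.rpow_lt_one hx.le hx1 (by linarith))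

theorem Expansion.lt_shockVelocity (hγ : 1 < γ) (hs : Expansion γ Uₗ Us r)
    (hr : Expansion γ Uₘ Uᵣ s) (hJ : IsJ Uₘ Uₗ) (hl : Uₗ.Supersonic γ) (hm : Uₘ.Supersonic γ)
    (hUs : Us.IsGas) (hUr : Uᵣ.IsGas) (hb : Us.a = Uᵣ.a) (hρ : Uₗ.ρ < Uₘ.ρ) :
    Us.p < Uᵣ.p ∧ Uᵣ.u < shockVelocity γ Us Uᵣ.p ∧ Uᵣ.p < standingPressure γ Us ∧
      shockVelocity γ Us (standingPressure γ Us) < Uᵣ.u := by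
  obtain ⟨hL, hM, ha, hu, hp, -⟩ := hJ
  have hc := c_sq_lt_c_sq hL hM hγ hp.symm hρ
  have hrs : r < s := by
    refine lt_of_stationaryFlux_eq hγ (pow_pos (hM.c_pos hγ) 2) hc
      (Supersonic.c_sq_lt hγ hM hm) hr.mem hs.mem ?_
    rw [hr.flux, hu, hs.flux, ha, hb]
  obtain ⟨h1, h2⟩ := hs.ratio hr hu hp ha hb
  have hr0 := hs.mem.1
  have hs0 := hr.mem.1
  have hx0 : 0 < s / r := div_pos hs0 hr0
  have hx : 1 < s / r := (one_lt_div hr0).2 hrs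
  have hul := Supersonic.u_pos hγ hL hl
  have husp := hs.u_pos hγ hL hUs hl
  have hlr := hr.u_lt hγ hM hUr hm
  rw [hu] at hlr
  have hbern := hs.u_sq hγ hL hUs
  have hcl := Supersonic.c_sq_lt hγ hL hl
  -- Two facts enter: `u₊ > uₘ = u₋` gives `x u₋ < u₋*`, and Bernoulli's law with `c₋ < u₋` gives
  -- `(γ - 1) u₋*² + 2 c₋*² < (γ + 1) u₋²`.
  have hD : 2 * Us.c γ ^ 2 * (s / r) ^ 2 < ((γ + 1) - (γ - 1) * (s / r) ^ 2) * Us.u ^ 2 := by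
    have h3 : s / r * Uₗ.u < Us.u := by
      rw [h2, lt_div_iff₀ hx0] at hlr
      linarith
    have h4 : (s / r * Uₗ.u) ^ 2 < Us.u ^ 2 := pow_lt_pow_left₀ h3 (by positivity) two_ne_zero
    have h5 : ((γ - 1) * Us.u ^ 2 + 2 * Us.c γ ^ 2) * (s / r) ^ 2 <
        ((γ + 1) * Uₗ.u ^ 2) * (s / r) ^ 2 :=
      mul_lt_mul_of_pos_right (by linarith) (by positivity)
    have h6 := mul_lt_mul_of_pos_left h4 (by linarith : 0 < γ + 1)
    nlinarith
  refine ⟨?_, Duct.lt_shockVelocity hγ hUs (hs.supersonic hγ hL hUs hl) hx h1 h2 hD,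
    lt_standingPressure hγ hUs hx h1 hD, ?_⟩
  · rw [h1]
    exact lt_mul_of_one_lt_right hUs.2.1 (Real.one_lt_rpow hx (by linarith))
  -- Prandtl's relation bounds the velocity behind the standing shock by `u₋² / u₋* < u₋`, and `u₋ <
  -- u₊`.
  · have h3 := shockVelocity_standingPressure hγ hUs husp
    rw [hbern] at h3
    have h4 : (γ + 1) * (Us.u * shockVelocity γ Us (standingPressure γ Us)) <
        (γ + 1) * (Us.u * Uₗ.u) := by
      rw [h3]
      have h5 := hs.u_lt hγ hL hUs hl
      have h6 : Uₗ.u * Uₗ.u < Us.u * Uₗ.u := mul_lt_mul_of_pos_right h5 hul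
      nlinarith
    have h5 := lt_of_mul_lt_mul_left (lt_of_mul_lt_mul_left h4 (by linarith)) husp.le
    linarith

/-- The collision itself is automatic, since the contact discontinuity moves with velocity `Uₘ.u >
0`. -/
theorem interaction_iff {out : List Wave} (hγ : 1 < γ) (hJ : IsJ Uₘ Uₗ) (hS : IsS0 γ Uᵣ Uₘ)
    (hm : Uₘ.Supersonic γ) :
    Interaction γ (.J Uₘ Uₗ) (.S0 Uᵣ Uₘ) out ↔
      (∀ w ∈ out, w.Valid γ) ∧ out.IsChain (Wave.FollowedBy γ) ∧
        out.head?.map Wave.left = some Uₗ ∧ out.getLast?.map Wave.right = some Uᵣ :=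
  ⟨fun h => ⟨h.valid_out, h.chain_out, h.left_out, h.right_out⟩, fun h =>
    ⟨hJ, hS, ⟨rfl, Supersonic.u_pos hγ hJ.2.1 hm⟩, h.1, h.2.1, h.2.2.1, h.2.2.2⟩⟩

/-- The rarefaction fan is determined by the pressure at the contact discontinuity. -/
theorem rareFan_iff (hγ : 1 < γ) (hJ : IsJ Uₘ Uₗ) (hS : IsS0 γ Uᵣ Uₘ)
    (hm : Uₘ.Supersonic γ) (hUs : IsS0 γ Us Uₗ) (hss : Us.Supersonic γ)
    (hb : Us.a = Uᵣ.a) (hp : Uᵣ.p < Us.p) (hκ : Us.kappa γ < Uᵣ.kappa γ) {V V' : State} :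
    Interaction γ (.J Uₘ Uₗ) (.S0 Uᵣ Uₘ) [.S0 Us Uₗ, .R1 V Us, .J V' V, .R3 Uᵣ V'] ↔
      ∃ p ∈ Ioo 0 Uᵣ.p, rareVelocity γ Us p + rareVelocity γ Uᵣ.reflect p = 0 ∧
        V = rareState γ Us p ∧ V' = (rareState γ Uᵣ.reflect p).reflect := by
  have hG : Us.IsGas := hUs.2.1
  have hR : Uᵣ.IsGas := hS.2.1
  rw [interaction_iff hγ hJ hS hm]
  constructor
  · rintro ⟨hv, -⟩
    have h1 : IsR1 γ V Us := hv (.R1 V Us) (by simp)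
    have h2 : IsJ V' V := hv (.J V' V) (by simp)
    have h3 : IsR3 γ Uᵣ V' := hv (.R3 Uᵣ V') (by simp)
    obtain ⟨hV, hV', -, hu, hpV, -⟩ := h2
    have e1 := h1.eq_rareState hγ hV
    have e2 := (isR3_iff_reflect.1 h3).eq_rareState hγ hV'
    have hpr : V'.p < Uᵣ.p := h3.2.2.2.2.2
    rw [reflect_p, hpV] at e2
    refine ⟨V.p, ⟨hV.2.1, hpV ▸ hpr⟩, ?_, e1, ?_⟩
    · have u1 : V.u = rareVelocity γ Us V.p := congrArg State.u e1
      have u2 : -V'.u = rareVelocity γ Uᵣ.reflect V.p := congrArg State.u e2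
      rw [← u1, ← u2, hu]
      ring
    · rw [← e2, reflect_reflect]
  · rintro ⟨p, ⟨hp0, hpr⟩, hsum, rfl, rfl⟩
    have hW : (rareState γ Us p).IsGas := rareState_isGas hG hp0
    have hW' : (rareState γ Uᵣ.reflect p).IsGas := rareState_isGas hR hp0
    have h1 := isR1_rareState hγ hG hp0 (hpr.trans hp)
    have h3 : IsR3 γ Uᵣ (rareState γ Uᵣ.reflect p).reflect :=
      isR3_iff_reflect.2 (by
        rw [reflect_reflect]
        exact isR1_rareState (U₀ := Uᵣ.reflect) hγ hR hp0 hpr)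
    have hu : (rareState γ Uᵣ.reflect p).reflect.u = (rareState γ Us p).u := by
      simp only [reflect_u, rareState]
      linarith
    have hρ : (rareState γ Uᵣ.reflect p).reflect.ρ ≠ (rareState γ Us p).ρ :=
      (rareState_rho_lt (W := Uᵣ.reflect) hγ hG hR hp0 hκ).ne
    have h2 : IsJ (rareState γ Uᵣ.reflect p).reflect (rareState γ Us p) :=
      ⟨hW, hW', hb.symm, hu, rfl, hρ⟩
    have hc := hW.c_pos hγ
    have hc' := hW'.c_pos hγ
    refine ⟨?_, ?_, rfl, rfl⟩
    · simp only [List.mem_cons, List.not_mem_nil, or_false]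
      rintro w (rfl | rfl | rfl | rfl)
      exacts [hUs, h1, h2, h3]
    · simp only [List.isChain_cons_cons, List.IsChain.singleton, and_true, Wave.FollowedBy]
      -- The speeds are ordered as `0 ≤ u - c` at `Us`, which is supersonic, then `u - c ≤ u` and `u
      -- ≤ u + c` at the contact.
      refine ⟨⟨Or.inl rfl, ?_⟩, ⟨Or.inl rfl, ?_⟩, ⟨Or.inl rfl, ?_⟩⟩
      · exact sub_nonneg.2 hss.le
      · exact sub_le_self _ hc.le
      · exact le_add_of_nonneg_right hc'.le

theorem IsS3.spec {σ : ℝ} {U U₀ : State} (hγ : 1 < γ) (h : IsS3 γ σ U U₀) :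
    U.p < U₀.p ∧ U₀ = (shockState γ U.reflect U₀.p).reflect ∧
      σ = -shockSpeed γ U.reflect U₀.p := by
  obtain ⟨h1, h2, h3⟩ := (isS3_iff_reflect.1 h).spec hγ
  refine ⟨h1, ?_, by rw [← reflect_p U₀, ← h3, neg_neg]⟩
  rw [← reflect_p U₀, ← h2, reflect_reflect]

theorem IsS3.velocity_lt_speed {σ : ℝ} {U U₀ : State} (hγ : 1 < γ) (h : IsS3 γ σ U U₀) :
    U₀.u < σ := by
  have := (isS3_iff_reflect.1 h).speed_lt_velocity hγ
  rw [reflect_u] at this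
  linarith

theorem isS3_shockState {U : State} (hγ : 1 < γ) (h : U.IsGas) {p : ℝ} (hp : U.p < p) :
    IsS3 γ (-shockSpeed γ U.reflect p) U (shockState γ U.reflect p).reflect := by
  rw [isS3_iff_reflect, neg_neg, reflect_reflect]
  exact isS1_shockState (U₀ := U.reflect) hγ h hp

/-- The shock fan is determined by the pressure at the contact discontinuity. -/
theorem shockFan_spec (hγ : 1 < γ) {V V' : State} {s₁ s₃ : ℝ}
    (h : Interaction γ (.J Uₘ Uₗ) (.S0 Uᵣ Uₘ) [.S0 Us Uₗ, .S1 V Us s₁, .J V' V, .S3 Uᵣ V' s₃]) :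
    ∃ p, Us.p < p ∧ Uᵣ.p < p ∧ shockVelocity γ Us p + shockVelocity γ Uᵣ.reflect p = 0 ∧
      V = shockState γ Us p ∧ V' = (shockState γ Uᵣ.reflect p).reflect ∧
      s₁ = shockSpeed γ Us p ∧ s₃ = -shockSpeed γ Uᵣ.reflect p := by
  have h1 : IsS1 γ s₁ V Us := h.valid_out (.S1 V Us s₁) (by simp)
  have h2 : IsJ V' V := h.valid_out (.J V' V) (by simp)
  have h3 : IsS3 γ s₃ Uᵣ V' := h.valid_out (.S3 Uᵣ V' s₃) (by simp)
  obtain ⟨p1, e1, q1⟩ := h1.spec hγ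
  obtain ⟨p3, e3, q3⟩ := h3.spec hγ
  rw [h2.2.2.2.2.1] at p3 e3 q3
  refine ⟨V.p, p1, p3, ?_, e1, e3, q1, q3⟩
  have u1 : V.u = shockVelocity γ Us V.p := congrArg State.u e1
  have u3 : V'.u = -shockVelocity γ Uᵣ.reflect V.p := congrArg State.u e3
  have hu : V'.u = V.u := h2.2.2.2.1
  linarith

theorem shockFan_interaction (hγ : 1 < γ) (hJ : IsJ Uₘ Uₗ) (hS : IsS0 γ Uᵣ Uₘ)
    (hm : Uₘ.Supersonic γ) (hUs : IsS0 γ Us Uₗ) (hb : Us.a = Uᵣ.a)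
    (hp : Us.p < Uᵣ.p) (hκ : Uᵣ.kappa γ < Us.kappa γ) {p : ℝ} (hpr : Uᵣ.p < p)
    (hsum : shockVelocity γ Us p + shockVelocity γ Uᵣ.reflect p = 0)
    (hσ : 0 ≤ shockSpeed γ Us p) :
    Interaction γ (.J Uₘ Uₗ) (.S0 Uᵣ Uₘ)
      [.S0 Us Uₗ, .S1 (shockState γ Us p) Us (shockSpeed γ Us p),
        .J (shockState γ Uᵣ.reflect p).reflect (shockState γ Us p),
        .S3 Uᵣ (shockState γ Uᵣ.reflect p).reflect (-shockSpeed γ Uᵣ.reflect p)] := by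
  have hG : Us.IsGas := hUs.2.1
  have hR : Uᵣ.IsGas := hS.2.1
  have hp0 : 0 < p := hR.2.1.trans hpr
  have h1 := isS1_shockState hγ hG (hp.trans hpr)
  have h3 := isS3_shockState hγ hR hpr
  have hu : (shockState γ Uᵣ.reflect p).reflect.u = (shockState γ Us p).u := by
    simp only [reflect_u, shockState]
    linarith
  have h2 : IsJ (shockState γ Uᵣ.reflect p).reflect (shockState γ Us p) :=
    ⟨shockState_isGas hγ hG hp0, shockState_isGas (U₀ := Uᵣ.reflect) hγ hR hp0, hb.symm, hu, rfl,
      (shockState_rho_lt (W := Uᵣ.reflect) hγ hG hR hp hpr hκ).ne'⟩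
  refine (interaction_iff hγ hJ hS hm).2 ⟨?_, ?_, rfl, rfl⟩
  · simp only [List.mem_cons, List.not_mem_nil, or_false]
    rintro w (rfl | rfl | rfl | rfl)
    exacts [hUs, h1, h2, h3]
  · simp only [List.isChain_cons_cons, List.IsChain.singleton, and_true, Wave.FollowedBy]
    exact ⟨⟨Or.inl rfl, hσ⟩, ⟨Or.inl rfl, (h1.speed_lt_velocity hγ).le⟩,
      ⟨Or.inl rfl, (h3.velocity_lt_speed hγ).le⟩⟩

theorem vacuumFan_interaction (hγ : 1 < γ) (hJ : IsJ Uₘ Uₗ) (hS : IsS0 γ Uᵣ Uₘ)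
    (hm : Uₘ.Supersonic γ) (hUs : IsS0 γ Us Uₗ) (hss : Us.Supersonic γ) (hb : Us.a = Uᵣ.a)
    (h : Us.u + 2 / (γ - 1) * Us.c γ ≤ Uᵣ.u - 2 / (γ - 1) * Uᵣ.c γ) :
    Interaction γ (.J Uₘ Uₗ) (.S0 Uᵣ Uₘ)
      [.S0 Us Uₗ, .R1 (rareVacuum γ Us) Us, .R3 Uᵣ (rareVacuum γ Uᵣ.reflect).reflect] := by
  have hG : Us.IsGas := hUs.2.1
  have hR : Uᵣ.IsGas := hS.2.1
  have v1 := rareVacuum_isVacuum (γ := γ) hG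
  have v3 : (rareVacuum γ Uᵣ.reflect).reflect.IsVacuum :=
    rareVacuum_isVacuum (γ := γ) (U₀ := Uᵣ.reflect) hR
  refine (interaction_iff hγ hJ hS hm).2 ⟨?_, ?_, rfl, rfl⟩
  · simp only [List.mem_cons, List.not_mem_nil, or_false]
    rintro w (rfl | rfl | rfl)
    exacts [hUs, isR1_rareVacuum hγ hG,
      isR3_iff_reflect.2 (by
        rw [reflect_reflect]
        exact isR1_rareVacuum (U₀ := Uᵣ.reflect) hγ hR)]
  · simp only [List.isChain_cons_cons, List.IsChain.singleton, and_true, Wave.FollowedBy]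
    refine ⟨⟨Or.inl rfl, sub_nonneg.2 hss.le⟩, ⟨Or.inr ⟨v1, v3, hb⟩, ?_⟩⟩
    -- At a vacuum `c = 0`, so the ordering of the two inner edges is precisely the vacuum criterion
    -- `h`.
    simp only [Wave.rightSpeed, Wave.leftSpeed, lam1, lam3, v1.c_eq_zero, v3.c_eq_zero]
    simp only [rareVacuum, reflect_u, reflect_c]
    linarith

end Duct

/-! ### The collision theorem. -/

open Duct State Set in
theorem lemma3p3 (γ : ℝ) (hγ : 1 < γ) (hγ' : γ < 3)
    (Uₗ Uₘ Uᵣ : Duct.State)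
    (hJ : Duct.IsJ Uₘ Uₗ) (hS : Duct.IsS0 γ Uᵣ Uₘ) (ha : Uₘ.a < Uᵣ.a)
    (hm : Uₘ.Supersonic γ) (hl : Uₗ.Supersonic γ) :
    ∃ Us : Duct.State,
      -- the stationary jump of the left state
      (Duct.IsS0 γ Us Uₗ ∧ Us.a = Uᵣ.a ∧ Us.Supersonic γ) ∧
      (∀ V : Duct.State, Duct.IsS0 γ V Uₗ → V.a = Uᵣ.a → V = Us) ∧
      (Uₘ.ρ < Uₗ.ρ →
        -- no vacuum
        (Uᵣ.u - 2 / (γ - 1) * Uᵣ.c γ < Us.u + 2 / (γ - 1) * Us.c γ →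
          ∃ U₂ U₂' : Duct.State,
            Duct.Interaction γ (.J Uₘ Uₗ) (.S0 Uᵣ Uₘ)
              [.S0 Us Uₗ, .R1 U₂ Us, .J U₂' U₂, .R3 Uᵣ U₂'] ∧
            ∀ V V' : Duct.State,
              Duct.Interaction γ (.J Uₘ Uₗ) (.S0 Uᵣ Uₘ)
                [.S0 Us Uₗ, .R1 V Us, .J V' V, .R3 Uᵣ V'] →
              V = U₂ ∧ V' = U₂') ∧
        -- vacuum
        (Us.u + 2 / (γ - 1) * Us.c γ ≤ Uᵣ.u - 2 / (γ - 1) * Uᵣ.c γ →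
          (∃ V V' : Duct.State, V.IsVacuum ∧ V'.IsVacuum ∧
            Duct.Interaction γ (.J Uₘ Uₗ) (.S0 Uᵣ Uₘ)
              [.S0 Us Uₗ, .R1 V Us, .R3 Uᵣ V']) ∧
          ¬ ∃ U₂ U₂' : Duct.State,
            Duct.Interaction γ (.J Uₘ Uₗ) (.S0 Uᵣ Uₘ)
              [.S0 Us Uₗ, .R1 U₂ Us, .J U₂' U₂, .R3 Uᵣ U₂'])) ∧
      (Uₗ.ρ < Uₘ.ρ →
        ∃ (U₃ U₃' : Duct.State) (σ₁ σ₃ : ℝ), 0 < σ₁ ∧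
          Duct.Interaction γ (.J Uₘ Uₗ) (.S0 Uᵣ Uₘ)
            [.S0 Us Uₗ, .S1 U₃ Us σ₁, .J U₃' U₃, .S3 Uᵣ U₃' σ₃] ∧
          ∀ (V V' : Duct.State) (s₁ s₃ : ℝ),
            Duct.Interaction γ (.J Uₘ Uₗ) (.S0 Uᵣ Uₘ)
              [.S0 Us Uₗ, .S1 V Us s₁, .J V' V, .S3 Uᵣ V' s₃] →
            V = U₃ ∧ V' = U₃' ∧ s₁ = σ₁ ∧ s₃ = σ₃) := by
  obtain ⟨s, hr⟩ := hS.exists_expansion hγ hm ha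
  have hL : Uₗ.IsGas := hJ.1
  have hR : Uᵣ.IsGas := hS.2.1
  have haL : Uₗ.a < Uᵣ.a := hJ.2.2.1 ▸ ha
  obtain ⟨Us, r, hG, hb, hs⟩ := exists_expansion hγ hL hl haL
  have hss := hs.supersonic hγ hL hG hl
  have hUs : IsS0 γ Us Uₗ := hs.isS0 hγ hL hG hl (hb ▸ haL)
  have hκs : Uₗ.kappa γ = Us.kappa γ := hUs.2.2.2.2.2.1
  have hκr : Uₘ.kappa γ = Uᵣ.kappa γ := hS.2.2.2.2.2.1
  have hrare₀ := rareVelocity_zero hγ Us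
  have hrare₀' := rareVelocity_zero hγ Uᵣ.reflect
  rw [reflect_u, reflect_c] at hrare₀'
  refine ⟨Us, ⟨hUs, hb, hss⟩, fun V hV hVa => ?_, fun hρ => ?_, fun hρ => ?_⟩
  · obtain ⟨t, ht⟩ := hV.exists_expansion hγ hl (hVa ▸ haL)
    exact ht.unique hγ hs hL hl (hVa.trans hb.symm)
  · obtain ⟨hp, hlt⟩ := hs.rareVelocity_lt hγ hr hJ hl hG hb hρ
    have hκ : Us.kappa γ < Uᵣ.kappa γ := by
      rw [← hκs, ← hκr]
      exact kappa_lt_kappa hJ.2.1 hγ hJ.2.2.2.2.1 hρ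
    have hanti : StrictAntiOn (fun p => rareVelocity γ Us p + rareVelocity γ Uᵣ.reflect p)
        (Ici 0) :=
      (strictAntiOn_rareVelocity hγ hG).add (strictAntiOn_rareVelocity (U₀ := Uᵣ.reflect) hγ hR)
    refine ⟨fun hnv => ?_, fun hvac => ⟨⟨_, (rareVacuum γ Uᵣ.reflect).reflect,
      rareVacuum_isVacuum (γ := γ) hG,
      rareVacuum_isVacuum (γ := γ) (U₀ := Uᵣ.reflect) hR,
      vacuumFan_interaction hγ hJ hS hm hUs hss hb hvac⟩, ?_⟩⟩
    · have hcont : Continuous fun p => rareVelocity γ Us p + rareVelocity γ Uᵣ.reflect p :=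
        (continuous_rareVelocity hγ Us).add (continuous_rareVelocity hγ Uᵣ.reflect)
      have hself : rareVelocity γ Uᵣ.reflect Uᵣ.p = -Uᵣ.u :=
        rareVelocity_self (U₀ := Uᵣ.reflect) hR
      -- The sum is positive at 0 by the no-vacuum condition and negative at `Uᵣ.p` by `hlt`.
      obtain ⟨p, hpI, hp0⟩ := intermediate_value_Ioo' hR.2.1.le hcont.continuousOn
        (show (0 : ℝ) ∈ Ioo _ _ from ⟨by linarith, by linarith⟩)
      refine ⟨_, _, (rareFan_iff hγ hJ hS hm hUs hss hb hp hκ).2 ⟨p, hpI, hp0, rfl, rfl⟩,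
        fun V V' hV => ?_⟩
      obtain ⟨q, hqI, hq0, rfl, rfl⟩ := (rareFan_iff hγ hJ hS hm hUs hss hb hp hκ).1 hV
      rw [hanti.injOn hqI.1.le hpI.1.le (hq0.trans hp0.symm)]
      exact ⟨rfl, rfl⟩
    · rintro ⟨V, V', hV⟩
      obtain ⟨q, hqI, hq0, -, -⟩ := (rareFan_iff hγ hJ hS hm hUs hss hb hp hκ).1 hV
      -- In the vacuum case the sum is already nonpositive at 0, so it has no root at a positive
      -- pressure.
      have := hanti (mem_Ici.2 le_rfl) (mem_Ici.2 hqI.1.le) hqI.1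
      simp only at this
      linarith
  · obtain ⟨hp, hlt, hst, hst'⟩ := hs.lt_shockVelocity hγ hr hJ hl hm hG hR hb hρ
    have hκ : Uᵣ.kappa γ < Us.kappa γ := by
      rw [← hκs, ← hκr]
      exact kappa_lt_kappa hL hγ hJ.2.2.2.2.1.symm hρ
    have hanti' := strictAntiOn_shockVelocity (U₀ := Uᵣ.reflect) hγ hR
    have hanti : StrictAntiOn (fun p => shockVelocity γ Us p + shockVelocity γ Uᵣ.reflect p)
        (Ici Uᵣ.p) :=
      ((strictAntiOn_shockVelocity hγ hG).mono (Ici_subset_Ici.2 hp.le)).add hanti'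
    have hcont : ContinuousOn (fun p => shockVelocity γ Us p + shockVelocity γ Uᵣ.reflect p)
        (Icc Uᵣ.p (standingPressure γ Us)) :=
      ((continuousOn_shockVelocity hγ hG).add
        (continuousOn_shockVelocity (U₀ := Uᵣ.reflect) hγ hR)).mono
        fun p hp => hR.2.1.le.trans hp.1
    have hself : shockVelocity γ Uᵣ.reflect Uᵣ.p = -Uᵣ.u := shockVelocity_self γ Uᵣ.reflect
    have hlt' : shockVelocity γ Uᵣ.reflect (standingPressure γ Us) < -Uᵣ.u :=
      hself ▸ hanti' (mem_Ici.2 le_rfl) (mem_Ici.2 hst.le) hst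
    obtain ⟨p, hpI, hp0⟩ := intermediate_value_Ioo' hst.le hcont
      (show (0 : ℝ) ∈ Ioo _ _ from ⟨by linarith, by linarith⟩)
    -- Below the standing pressure the mass flux through the shock is less than `ρ u`, so the shock
    -- moves to the right.
    have hσ : 0 < shockSpeed γ Us p := by
      have h1 := shockFlux_lt_shockFlux hγ hG (hR.2.1.trans hpI.1).le hpI.2
      rw [shockFlux_standingPressure hγ hG (Supersonic.u_pos hγ hG hss)] at h1
      exact sub_pos.2 ((div_lt_iff₀' hG.1).2 h1)
    refine ⟨_, _, _, _, hσ,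
      shockFan_interaction hγ hJ hS hm hUs hb hp hκ hpI.1 hp0 hσ.le, fun V V' s₁ s₃ hV => ?_⟩
    -- Any competing fan gives a root above `Uᵣ.p`, where the sum is injective; its shock speeds are
    -- functions of that root.
    obtain ⟨q, -, hqr, hq0, rfl, rfl, rfl, rfl⟩ := shockFan_spec hγ hV
    rw [hanti.injOn hqr.le hpI.1.le (hq0.trans hp0.symm)]
    exact ⟨rfl, rfl, rfl, rfl⟩
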